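/- **Setting.** A *special base sequence* is a strictly increasing sequence of integers $0=k_0<k_1<k_2<\cdots$ such that $k_{j+1}/k_j$, $j\ge 1$, is bounded. A *weight function* is a continuous (weakly) increasing function $\omega:[0,\infty)\to[0,\infty)$ with $\omega(0)=0$, $\omega(2t)=O(\omega(t))$ and $\log t=o(\omega(t))$ as $t\to\infty$, such that $\varphi(t):=\omega(e^t)$ is convex on $\mathbb R$. Put $\varphi^*(s):=\sup_{t\ge0}(st-\varphi(t))$ and $W_\rho(k):=\exp\big(\tfrac1\rho\varphi^*(\rho k)\big)$ for $\rho>0$, $k\in\mathbb N$. Functions are real- or complex-valued, $1\le p\le\infty$, and $[\omega]$ stands for $\{\omega\}$ (Roumieu case) or $(\omega)$ (Beurling case). Below, "for $[\rho]$" means "for some $\rho>0$" in the Roumieu case and "for all $\rho>0$" in the Beurling case, and $\alpha,\beta\in\mathbb N^n$ are multi-indices. - For $U\subseteq\mathbb R^n$ open, $\mathcal E^{[\omega]}_{L^p}(U)$ is the set of $f\in C^\infty(U)$ such that for every open $\Omega$ that is relatively compact in $U$, and for $[\rho]$, there is $C>0$ with $\|\partial^\alpha f\|_{L^p(\Omega)}\le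 C\,W_\rho(|\alpha|)$ for all $\alpha$. - $\mathcal B^{[\omega]}_{L^p}(\mathbb R^n)$ is the set of $f\in C^\infty(\mathbb R^n)$ such that for $[\rho]$ there is $C>0$ with $\|\partial^\alpha f\|_{L^p(\mathbb R^n)}\le C\,W_\rho(|\alpha|)$ for all $\alpha$. - $\mathcal D^{[\omega]}(\mathbb R^n):=\mathcal B^{[\omega]}_{L^\infty}(\mathbb R^n)\cap C^\infty_c(\mathbb R^n)$. - $\mathcal S^{[\omega]}(\mathbb R^n)$ is the set of $f\in C^\infty(\mathbb R^n)$ such that for $[\rho]$ and $[\sigma]$ there is $C>0$ with $|x^\alpha\partial^\beta f(x)|\le C\,W_\rho(|\alpha|)\,W_\sigma(|\beta|)$ for all $\alpha,\beta$ and all $x\in\mathbb R^n$. The lacunary classes $\mathcal E^{[\omega]}_{L^p,(k_j)}(U)$, $\mathcal B^{[\omega]}_{L^p,(k_j)}(\mathbb R^n)$, $\mathcal D^{[\omega]}_{(k_j)}(\mathbb R^n)$ are defined in the same way, but with the estimates required only for those $\alpha$ with $|\alpha|=k_j$ for some $j\ge0$. The class $\mathcal S^{[\omega]}_{(k_j),(\ell_j)}(\mathbb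 R^n)$ is the set of $f\in C^\infty(\mathbb R^n)$ such that for $[\rho]$ and $[\sigma]$ there is $C>0$ such that, for all $j\ge0$, $$\max_{|\alpha|=k_j}\sup_{x\in\mathbb R^n}|x^\alpha f(x)|\le C\,W_\rho(k_j)\quad\text{and}\quad \max_{|\beta|=\ell_j}\sup_{x\in\mathbb R^n}|\partial^\beta f(x)|\le C\,W_\sigma(\ell_j).$$ **Theorem.** Let $1\le p\le\infty$, let $(k_j)$ and $(\ell_j)$ be special base sequences, and let $\omega$ be a weight function. Then, in the Roumieu and in the Beurling case, (a) $\mathcal B^{[\omega]}_{L^p,(k_j)}(\mathbb R^n)=\mathcal B^{[\omega]}_{L^p}(\mathbb R^n)$; (b) $\mathcal D^{[\omega]}_{(k_j)}(\mathbb R^n)=\mathcal D^{[\omega]}(\mathbb R^n)$. Assume additionally that $\omega(t)=O(t)$ as $t\to\infty$ in the Roumieu case, and $\omega(t)=o(t)$ as $t\to\infty$ in the Beurling case. Then (c) $\mathcal E^{[\omega]}_{L^p,(k_j)}(U)=\mathcal E^{[\omega]}_{L^p}(U)$ for all open $U\subseteq\mathbb R^n$; (d) $\mathcal S^{[\omega]}_{(k_j),(\ell_j)}(\mathbb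 R^n)=\mathcal S^{[\omega]}(\mathbb R^n)$. -/

import Mathlib

open scoped ENNReal
open MeasureTheory Filter Asymptotics Set

noncomputable section

namespace LacunaryBMT

/-- A base sequence `0 = k₀ < k₁ < k₂ < ⋯` of integers. -/
def IsBaseSequence (k : ℕ → ℕ) : Prop :=
  k 0 = 0 ∧ StrictMono k

/-- A base sequence such that the quotients `k_{j+1} / k_j`, `j ≥ 1`, are bounded. -/
def IsSpecialBaseSequence (k : ℕ → ℕ) : Prop :=
  IsBaseSequence k ∧ ∃ A : ℝ, ∀ j : ℕ, 1 ≤ j → (k (j + 1) : ℝ) / (k j : ℝ) ≤ A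

/-- Weight functions `ω : [0,∞) → [0,∞)`. Only the values of `ω` on `[0,∞)` matter.
"Increasing" is meant in the wide sense. -/
structure IsWeightFunction (ω : ℝ → ℝ) : Prop where
  continuousOn : ContinuousOn ω (Ici 0)
  monotoneOn : MonotoneOn ω (Ici 0)
  nonneg : ∀ t : ℝ, 0 ≤ t → 0 ≤ ω t
  map_zero : ω 0 = 0
  doubling : (fun t : ℝ => ω (2 * t)) =O[atTop] ω
  log_isLittleO : Real.log =o[atTop] ω
  convexOn : ConvexOn ℝ univ fun t : ℝ => ω (Real.exp t)

/-- `φ*(s) = sup_{t ≥ 0} (s t - φ(t))`, where `φ(t) = ω(e^t)`. -/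
def youngConj (ω : ℝ → ℝ) (s : ℝ) : ℝ :=
  sSup ((fun t : ℝ => s * t - ω (Real.exp t)) '' Ici 0)

/-- For a weight function the supremum in `youngConj` is a genuine (finite) one. -/
theorem IsWeightFunction.bddAbove {ω : ℝ → ℝ} (h : IsWeightFunction ω) (s : ℝ) :
    BddAbove ((fun t : ℝ => s * t - ω (Real.exp t)) '' Ici 0) := by
  have hc : (0 : ℝ) < 1 / (|s| + 1) := by positivity
  have h1 := (h.log_isLittleO.comp_tendsto Real.tendsto_exp_atTop).bound hc
  obtain ⟨T, hT⟩ := eventually_atTop.1 h1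
  refine ⟨|s| * |T|, ?_⟩
  rintro _ ⟨t, ht, rfl⟩
  have ht0 : (0 : ℝ) ≤ t := ht
  have hω : 0 ≤ ω (Real.exp t) := h.nonneg _ (Real.exp_pos t).le
  have hs : s * t ≤ |s| * t := mul_le_mul_of_nonneg_right (le_abs_self s) ht0
  rcases le_total T t with hTt | hTt
  · have h2 := hT t hTt
    simp only [Function.comp, Real.log_exp, Real.norm_eq_abs, abs_of_nonneg ht0,
      abs_of_nonneg hω] at h2
    have h3 : (|s| + 1) * t ≤ ω (Real.exp t) := by
      have h4 := mul_le_mul_of_nonneg_left h2 (by positivity : (0 : ℝ) ≤ |s| + 1)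
      have h5 : (|s| + 1) * (1 / (|s| + 1) * ω (Real.exp t)) = ω (Real.exp t) := by
        field_simp
      rwa [h5] at h4
    have h6 : 0 ≤ |s| * |T| := by positivity
    change s * t - ω (Real.exp t) ≤ |s| * |T|
    nlinarith
  · have h7 : |s| * t ≤ |s| * |T| :=
      mul_le_mul_of_nonneg_left (hTt.trans (le_abs_self T)) (abs_nonneg s)
    change s * t - ω (Real.exp t) ≤ |s| * |T|
    linarith

/-- The weight `exp (φ*(ρ k) / ρ)`. -/
def bmtWeight (ω : ℝ → ℝ) (ρ : ℝ) (k : ℕ) : ℝ :=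
  Real.exp (1 / ρ * youngConj ω (ρ * (k : ℝ)))

/-- The two types of ultradifferentiable classes. -/
inductive ClassType where
  | roumieu
  | beurling

/-- "For some `ρ > 0`" in the Roumieu case, "for all `ρ > 0`" in the Beurling case. -/
def ClassType.Param (τ : ClassType) (P : ℝ → Prop) : Prop :=
  match τ with
  | .roumieu => ∃ ρ : ℝ, 0 < ρ ∧ P ρ
  | .beurling => ∀ ρ : ℝ, 0 < ρ → P ρ

/-- `ω(t) = O(t)` in the Roumieu case, `ω(t) = o(t)` in the Beurling case, as `t → ∞`. -/
def ClassType.Growth (τ : ClassType) (ω : ℝ → ℝ) : Prop :=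
  match τ with
  | .roumieu => ω =O[atTop] fun t : ℝ => t
  | .beurling => ω =o[atTop] fun t : ℝ => t

/-- The length `|α|` of a multi-index. -/
def mlen {n : ℕ} (α : Fin n → ℕ) : ℕ := ∑ i, α i

/-- The monomial `x^α`. -/
def monom {n : ℕ} (α : Fin n → ℕ) (x : EuclideanSpace ℝ (Fin n)) : ℝ := ∏ i, x i ^ α i

variable {𝕜 : Type*} [RCLike 𝕜]

/-- The partial derivative `∂_i f`. -/
def pderiv {n : ℕ} (i : Fin n) (f : EuclideanSpace ℝ (Fin n) → 𝕜) :
    EuclideanSpace ℝ (Fin n) → 𝕜 :=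
  fun x => lineDeriv ℝ f x (EuclideanSpace.single i (1 : ℝ))

/-- The partial derivative `∂^α f = ∂_1^{α_1} ⋯ ∂_n^{α_n} f`. -/
def mderiv {n : ℕ} (α : Fin n → ℕ) (f : EuclideanSpace ℝ (Fin n) → 𝕜) :
    EuclideanSpace ℝ (Fin n) → 𝕜 :=
  (List.finRange n).foldr (fun i g => (pderiv i)^[α i] g) f

/-- The norm `‖∂^α f‖_{L^p(Ω)}`, with values in `[0,∞]`. -/
def derivNorm {n : ℕ} (p : ℝ≥0∞) (Ω : Set (EuclideanSpace ℝ (Fin n))) (α : Fin n → ℕ)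
    (f : EuclideanSpace ℝ (Fin n) → 𝕜) : ℝ≥0∞ :=
  eLpNorm (mderiv α f) p (volume.restrict Ω)

/-- `Ω` is open and relatively compact in `U`. -/
def RelCompactOpen {n : ℕ} (Ω U : Set (EuclideanSpace ℝ (Fin n))) : Prop :=
  IsOpen Ω ∧ IsCompact (closure Ω) ∧ closure Ω ⊆ U

section Classes

variable (𝕜) {n : ℕ} (τ : ClassType) (ω : ℝ → ℝ)

/-- The local class `𝓔^{[ω]}_{L^p}(U)`. A function on the open set `U` is represented by a function
on `ℝⁿ`, of which only the restriction to `U` is used. -/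
def classE (p : ℝ≥0∞) (U : Set (EuclideanSpace ℝ (Fin n))) :
    Set (EuclideanSpace ℝ (Fin n) → 𝕜) :=
  {f | ContDiffOn ℝ (⊤ : ℕ∞) f U ∧ ∀ Ω, RelCompactOpen Ω U → τ.Param fun ρ => ∃ C : ℝ, 0 < C ∧
    ∀ α : Fin n → ℕ, derivNorm p Ω α f ≤ ENNReal.ofReal (C * bmtWeight ω ρ (mlen α))}

/-- The lacunary local class `𝓔^{[ω]}_{L^p,(k_j)}(U)`. -/
def classELac (p : ℝ≥0∞) (k : ℕ → ℕ) (U : Set (EuclideanSpace ℝ (Fin n))) :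
    Set (EuclideanSpace ℝ (Fin n) → 𝕜) :=
  {f | ContDiffOn ℝ (⊤ : ℕ∞) f U ∧ ∀ Ω, RelCompactOpen Ω U → τ.Param fun ρ => ∃ C : ℝ, 0 < C ∧
    ∀ (j : ℕ) (α : Fin n → ℕ), mlen α = k j →
      derivNorm p Ω α f ≤ ENNReal.ofReal (C * bmtWeight ω ρ (k j))}

variable (n)

/-- The global class `𝓑^{[ω]}_{L^p}(ℝⁿ)`. -/
def classB (p : ℝ≥0∞) : Set (EuclideanSpace ℝ (Fin n) → 𝕜) :=
  {f | ContDiff ℝ (⊤ : ℕ∞) f ∧ τ.Param fun ρ => ∃ C : ℝ, 0 < C ∧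
    ∀ α : Fin n → ℕ, derivNorm p univ α f ≤ ENNReal.ofReal (C * bmtWeight ω ρ (mlen α))}

/-- The lacunary global class `𝓑^{[ω]}_{L^p,(k_j)}(ℝⁿ)`. -/
def classBLac (p : ℝ≥0∞) (k : ℕ → ℕ) : Set (EuclideanSpace ℝ (Fin n) → 𝕜) :=
  {f | ContDiff ℝ (⊤ : ℕ∞) f ∧ τ.Param fun ρ => ∃ C : ℝ, 0 < C ∧
    ∀ (j : ℕ) (α : Fin n → ℕ), mlen α = k j →
      derivNorm p univ α f ≤ ENNReal.ofReal (C * bmtWeight ω ρ (k j))}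

/-- The class `𝓓^{[ω]}(ℝⁿ)` of compactly supported functions in `𝓑^{[ω]}_{L^∞}(ℝⁿ)`. -/
def classD : Set (EuclideanSpace ℝ (Fin n) → 𝕜) :=
  {f | f ∈ classB 𝕜 n τ ω ∞ ∧ HasCompactSupport f}

/-- The lacunary class `𝓓^{[ω]}_{(k_j)}(ℝⁿ)`. -/
def classDLac (k : ℕ → ℕ) : Set (EuclideanSpace ℝ (Fin n) → 𝕜) :=
  {f | f ∈ classBLac 𝕜 n τ ω ∞ k ∧ HasCompactSupport f}

/-- The Gelfand–Shilov class `𝓢^{[ω]}(ℝⁿ)`. -/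
def classS : Set (EuclideanSpace ℝ (Fin n) → 𝕜) :=
  {f | ContDiff ℝ (⊤ : ℕ∞) f ∧ τ.Param fun ρ => τ.Param fun σ => ∃ C : ℝ, 0 < C ∧
    ∀ (α β : Fin n → ℕ) (x : EuclideanSpace ℝ (Fin n)),
      ‖monom α x • mderiv β f x‖ ≤ C * (bmtWeight ω ρ (mlen α) * bmtWeight ω σ (mlen β))}

/-- The lacunary Gelfand–Shilov class `𝓢^{[ω]}_{(k_j),(ℓ_j)}(ℝⁿ)`. -/
def classSLac (k l : ℕ → ℕ) : Set (EuclideanSpace ℝ (Fin n) → 𝕜) :=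
  {f | ContDiff ℝ (⊤ : ℕ∞) f ∧ τ.Param fun ρ => τ.Param fun σ => ∃ C : ℝ, 0 < C ∧
    ∀ j : ℕ,
      (∀ (α : Fin n → ℕ) (x : EuclideanSpace ℝ (Fin n)), mlen α = k j →
        ‖monom α x • f x‖ ≤ C * bmtWeight ω ρ (k j)) ∧
      (∀ (β : Fin n → ℕ) (x : EuclideanSpace ℝ (Fin n)), mlen β = l j →
        ‖mderiv β f x‖ ≤ C * bmtWeight ω σ (l j))}

end Classes

end LacunaryBMT

end

/-! Write `W_ρ` for `bmtWeight ω ρ`. Everything rests on an interpolation inequality whose constant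
grows only exponentially in the order: if the derivatives of order `a` are bounded by `A` and those
of order `a + d` by `A * R ^ d`, then those of order `a + i`, `i ≤ d`, are bounded by `K ^ d * (A *
R ^ i)` with `K` depending on `n` only (`derivNorm_interpolate`). It comes from recovering a Taylor
coefficient from `N` equispaced values with weights bounded by `(4e) ^ N` (`exists_weights_coeff`),
using steps of length `d / R`.

Let `m = a + i` lie between consecutive base orders `a` and `a + d`. Since the sequence is special,
`a + d ≤ A * m`. Two losses occur, and both are absorbed by enlarging `ρ` by a fixed factor. The
geometric factor `K ^ d ≤ (K ^ A) ^ m` is absorbed because `ω(2t) = O(ω(t))` (`bmtWeight_pow`). The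
logarithmic interpolation of `W_ρ(a)` and `W_ρ(a + d)` is at most a constant times `W_{Aρ}(m)`,
because `φ* + ω(1)` is star-shaped (`bmtWeight_interpolate`). A fixed factor on `ρ` is harmless in
the Roumieu and in the Beurling case. `exists_bound_of_lacunary` combines these facts.

On `ℝⁿ` steps of any length are allowed, which gives (a) and (b). On subsets of `U` the step `d / R`
must be small. The choice of `R` and supermultiplicativity give `R ^ d ≥ D * W_ρ(d)`, while the
growth condition gives `D * W_ρ(d) ≥ (d / δ) ^ d`; hence `d / R ≤ δ`, and (c) follows after a
cutoff.

For (d), the lacunary bounds first yield separate bounds on all moments of `f` and on all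
derivatives. Mixed bounds follow by interpolating near a point `x` between orders `0` and `2 * |β|`:
the derivative of order `|β|` is the midpoint, and `W_ρ(2m) = W_{2ρ}(m) ^ 2` turns the geometric
mean into the required product. -/

noncomputable section

namespace LacunaryBMT

/-! ### Inequalities for the weights and handling of the parameter. -/

section Weights

variable {ω : ℝ → ℝ}

theorem IsWeightFunction.le_youngConj (h : IsWeightFunction ω) (s : ℝ) {t : ℝ} (ht : 0 ≤ t) :
    s * t - ω (Real.exp t) ≤ youngConj ω s :=
  le_csSup (h.bddAbove s) ⟨t, ht, rfl⟩

theorem youngConj_le {s B : ℝ} (hB : ∀ t, 0 ≤ t → s * t - ω (Real.exp t) ≤ B) :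
    youngConj ω s ≤ B := by
  refine csSup_le ⟨_, 0, le_refl (0 : ℝ), rfl⟩ ?_
  rintro _ ⟨t, ht, rfl⟩
  exact hB t ht

theorem IsWeightFunction.one_le (h : IsWeightFunction ω) {t : ℝ} (ht : 0 ≤ t) :
    ω 1 ≤ ω (Real.exp t) :=
  h.monotoneOn (by simp) (Real.exp_pos t).le (Real.one_le_exp ht)

theorem youngConj_mono (h : IsWeightFunction ω) : Monotone (youngConj ω) := by
  intro s s' hs
  refine youngConj_le fun t ht => le_trans ?_ (h.le_youngConj s' ht)
  have := mul_le_mul_of_nonneg_right hs ht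
  linarith

theorem youngConj_zero (h : IsWeightFunction ω) : youngConj ω 0 = -ω 1 := by
  apply le_antisymm
  · exact youngConj_le fun t ht => by have := h.one_le ht; linarith
  · have := h.le_youngConj 0 le_rfl
    simpa using this

/-- `φ* + ω(1)` is star-shaped. -/
theorem youngConj_smul_le (h : IsWeightFunction ω) {θ : ℝ} (h0 : 0 ≤ θ) (h1 : θ ≤ 1) (s : ℝ) :
    youngConj ω (θ * s) + ω 1 ≤ θ * (youngConj ω s + ω 1) := by
  rw [← le_sub_iff_add_le]
  refine youngConj_le fun t ht => ?_
  -- Since `φ(t) ≥ ω(1)` for `t ≥ 0`, the nonpositive number `ω(1) - φ(t)` only increases when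
  -- multiplied by `θ ≤ 1`.
  have a1 := h.one_le ht
  have a2 := mul_le_mul_of_nonneg_left (h.le_youngConj s ht) h0
  nlinarith

theorem youngConj_div_mono (h : IsWeightFunction ω) {x y : ℝ} (hx : 0 ≤ x) (hy : 0 < y)
    (hxy : x ≤ y) : youngConj ω x + ω 1 ≤ x / y * (youngConj ω y + ω 1) := by
  have := youngConj_smul_le h (div_nonneg hx hy.le) ((div_le_one hy).2 hxy) y
  rwa [div_mul_cancel₀ _ hy.ne'] at this

theorem bmtWeight_pos (ω : ℝ → ℝ) (ρ : ℝ) (k : ℕ) : 0 < bmtWeight ω ρ k := Real.exp_pos _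

theorem bmtWeight_mono (h : IsWeightFunction ω) {ρ : ℝ} (hρ : 0 < ρ) :
    Monotone (bmtWeight ω ρ) := by
  intro a b hab
  unfold bmtWeight
  gcongr
  exact youngConj_mono h (by gcongr)

theorem bmtWeight_zero_le_one (h : IsWeightFunction ω) {ρ : ℝ} (hρ : 0 < ρ) :
    bmtWeight ω ρ 0 ≤ 1 := by
  unfold bmtWeight
  simp only [Nat.cast_zero, mul_zero, youngConj_zero h]
  have := h.nonneg 1 zero_le_one
  rw [Real.exp_le_one_iff]
  have : 0 ≤ 1 / ρ * ω 1 := by positivity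
  linarith

/-- The weights increase with the parameter up to a constant, so a Roumieu parameter may be enlarged
freely. -/
theorem bmtWeight_le_of_le (h : IsWeightFunction ω) {ρ ρ' : ℝ} (hρ : 0 < ρ) (hρ' : ρ ≤ ρ')
    (k : ℕ) : bmtWeight ω ρ k ≤ Real.exp (ω 1 / ρ') * bmtWeight ω ρ' k := by
  have hρ'0 : 0 < ρ' := hρ.trans_le hρ'
  unfold bmtWeight
  rw [← Real.exp_add, Real.exp_le_exp]
  have h1 := youngConj_smul_le h (div_nonneg hρ.le hρ'0.le) ((div_le_one hρ'0).2 hρ') (ρ' * k)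
  rw [show ρ / ρ' * (ρ' * k) = ρ * k by field_simp] at h1
  have h2 := mul_le_mul_of_nonneg_left h1 (one_div_pos.2 hρ).le
  rw [show 1 / ρ * (ρ / ρ' * (youngConj ω (ρ' * k) + ω 1)) =
    ω 1 / ρ' + 1 / ρ' * youngConj ω (ρ' * k) by field_simp; ring] at h2
  have h3 : 0 ≤ 1 / ρ * ω 1 := mul_nonneg (by positivity) (h.nonneg 1 zero_le_one)
  linarith

/-- Supermultiplicativity: a star-shaped function is superadditive, and the surplus `ω(1) ≥ 0` has
the right sign. It is what bounds the interpolation step from above in the local case. -/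
theorem bmtWeight_mul_le (h : IsWeightFunction ω) {ρ : ℝ} (hρ : 0 < ρ) (a b : ℕ) :
    bmtWeight ω ρ a * bmtWeight ω ρ b ≤ bmtWeight ω ρ (a + b) := by
  rcases Nat.eq_zero_or_pos (a + b) with h0 | h0
  · obtain ⟨rfl, rfl⟩ : a = 0 ∧ b = 0 := by omega
    have := bmtWeight_zero_le_one h hρ
    exact mul_le_of_le_one_left (bmtWeight_pos _ _ _).le this
  unfold bmtWeight
  rw [← Real.exp_add, Real.exp_le_exp, ← mul_add]
  refine mul_le_mul_of_nonneg_left ?_ (by positivity)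
  have hs : (0 : ℝ) < ρ * ((a + b : ℕ) : ℝ) := by positivity
  have ha := youngConj_div_mono h (x := ρ * a) (by positivity) hs (by push_cast; gcongr; simp)
  have hb := youngConj_div_mono h (x := ρ * b) (by positivity) hs (by push_cast; gcongr; simp)
  have hsum : ρ * a / (ρ * ((a + b : ℕ) : ℝ)) + ρ * b / (ρ * ((a + b : ℕ) : ℝ)) = 1 := by
    rw [← add_div, ← mul_add, ← Nat.cast_add]; exact div_self hs.ne'
  have hω := h.nonneg 1 zero_le_one
  have key := add_le_add ha hb
  rw [← add_mul, hsum] at key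
  linarith

theorem bmtWeight_two_mul (ρ : ℝ) (hρ : 0 < ρ) (m : ℕ) :
    bmtWeight ω ρ (2 * m) = bmtWeight ω (2 * ρ) m ^ 2 := by
  unfold bmtWeight
  rw [← Real.exp_nat_mul]
  congr 1
  push_cast
  rw [show ρ * (2 * (m : ℝ)) = 2 * ρ * m by ring]
  field_simp

theorem IsWeightFunction.exists_doubling (h : IsWeightFunction ω) :
    ∃ L : ℝ, 1 ≤ L ∧ ∀ t, 0 ≤ t → ω (2 * t) ≤ L * ω t + L := by
  obtain ⟨c, hc⟩ := h.doubling.bound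
  obtain ⟨T, hT⟩ := eventually_atTop.1 hc
  refine ⟨max 1 (max c (ω (2 * |T|))), le_max_left _ _, fun t ht => ?_⟩
  set L := max 1 (max c (ω (2 * |T|)))
  have hL : 0 ≤ L := zero_le_one.trans (le_max_left _ _)
  have hωt := h.nonneg t ht
  rcases le_total T t with h1 | h1
  · have := hT t h1
    rw [Real.norm_of_nonneg (h.nonneg _ (by positivity)), Real.norm_of_nonneg hωt] at this
    have h2 : c * ω t ≤ L * ω t :=
      mul_le_mul_of_nonneg_right ((le_max_left _ _).trans (le_max_right _ _)) hωt
    linarith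
  · have h2 : ω (2 * t) ≤ ω (2 * |T|) :=
      h.monotoneOn (by simp [ht]) (by simp) (by linarith [le_abs_self T])
    have h3 : ω (2 * |T|) ≤ L := (le_max_right _ _).trans (le_max_right _ _)
    have := mul_nonneg hL hωt
    linarith

/-- Shifting `t` by `log 2` in the supremum defining `φ*` produces the factor `2 ^ m`; the cost `φ(t
+ log 2) ≤ L φ(t) + L` is paid by the larger parameter `L * ρ`. -/
theorem bmtWeight_two_pow (h : IsWeightFunction ω) :
    ∃ L : ℝ, 1 ≤ L ∧ ∀ ρ, 0 < ρ → ∀ m : ℕ,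
      2 ^ m * bmtWeight ω ρ m ≤ Real.exp (1 / ρ) * bmtWeight ω (L * ρ) m := by
  obtain ⟨L, hL, hd⟩ := h.exists_doubling
  have hL0 : 0 < L := by linarith
  refine ⟨L, hL, fun ρ hρ m => ?_⟩
  have key : youngConj ω (ρ * m) ≤ (youngConj ω (L * ρ * m) - L * ρ * m * Real.log 2 + L) / L := by
    refine youngConj_le fun t ht => ?_
    rw [le_div_iff₀ hL0]
    have h1 := hd (Real.exp t) (Real.exp_pos t).le
    have hlog : 0 < Real.log 2 := Real.log_pos (by norm_num)
    have h2 := h.le_youngConj (L * ρ * m) (t := t + Real.log 2) (by positivity)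
    rw [Real.exp_add, Real.exp_log (by norm_num), mul_comm (Real.exp t)] at h2
    nlinarith
  have h2 : (2 : ℝ) ^ m = Real.exp (m * Real.log 2) := by
    rw [mul_comm, Real.exp_mul, Real.exp_log (by norm_num), Real.rpow_natCast]
  unfold bmtWeight
  rw [h2, ← Real.exp_add, ← Real.exp_add, Real.exp_le_exp]
  have h3 := mul_le_mul_of_nonneg_left key (one_div_pos.2 hρ).le
  have h4 : 1 / ρ * ((youngConj ω (L * ρ * m) - L * ρ * m * Real.log 2 + L) / L) =
    1 / ρ + 1 / (L * ρ) * youngConj ω (L * ρ * m) - m * Real.log 2 := by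
    field_simp; ring
  rw [h4] at h3
  linarith

theorem bmtWeight_pow (h : IsWeightFunction ω) (K : ℝ) :
    ∃ L : ℝ, 0 < L ∧ ∀ ρ, 0 < ρ → ∃ D : ℝ, 0 < D ∧ ∀ m : ℕ,
      |K| ^ m * bmtWeight ω ρ m ≤ D * bmtWeight ω (L * ρ) m := by
  obtain ⟨L, hL, h2⟩ := bmtWeight_two_pow h
  have hL0 : 0 < L := by linarith
  obtain ⟨r, hr⟩ := pow_unbounded_of_one_lt |K| (one_lt_two : (1 : ℝ) < 2)
  have claim : ∀ r : ℕ, ∀ ρ, 0 < ρ → ∃ D : ℝ, 0 < D ∧ ∀ m : ℕ,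
      ((2 : ℝ) ^ r) ^ m * bmtWeight ω ρ m ≤ D * bmtWeight ω (L ^ r * ρ) m := by
    intro r
    induction r with
    | zero => intro ρ hρ; exact ⟨1, one_pos, fun m => by simp⟩
    | succ r ih =>
      intro ρ hρ
      obtain ⟨D, hD, hm⟩ := ih ρ hρ
      have hρ' : 0 < L ^ r * ρ := by positivity
      refine ⟨D * Real.exp (1 / (L ^ r * ρ)), by positivity, fun m => ?_⟩
      have e1 := mul_le_mul_of_nonneg_left (hm m) (by positivity : (0 : ℝ) ≤ 2 ^ m)
      have e2 := mul_le_mul_of_nonneg_left (h2 _ hρ' m) hD.le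
      calc ((2 : ℝ) ^ (r + 1)) ^ m * bmtWeight ω ρ m
          = 2 ^ m * (((2 : ℝ) ^ r) ^ m * bmtWeight ω ρ m) := by
            rw [pow_succ, mul_pow]; ring
        _ ≤ 2 ^ m * (D * bmtWeight ω (L ^ r * ρ) m) := e1
        _ = D * (2 ^ m * bmtWeight ω (L ^ r * ρ) m) := by ring
        _ ≤ _ := e2
        _ = _ := by rw [pow_succ' L, mul_assoc L, mul_assoc]
  refine ⟨L ^ r, by positivity, fun ρ hρ => ?_⟩
  obtain ⟨D, hD, hm⟩ := claim r ρ hρ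
  refine ⟨D, hD, fun m => le_trans ?_ (hm m)⟩
  have := (bmtWeight_pos ω ρ m).le
  gcongr

/-- The logarithmic interpolation of the weights at `a ≤ m ≤ b` is controlled by the weight at `m`
with a larger parameter, if `b ≤ A m`. -/
theorem bmtWeight_interpolate (h : IsWeightFunction ω) {ρ A D R : ℝ} (hρ : 0 < ρ) (hA : 1 ≤ A)
    (hD : 1 ≤ D) (hR : 0 < R) {a i k : ℕ} (hk : 0 < k) (hik : i ≤ k) (hm : 0 < a + i)
    (hb : ((a + k : ℕ) : ℝ) ≤ A * ((a + i : ℕ) : ℝ))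
    (hRk : R ^ k = D * bmtWeight ω ρ (a + k) / bmtWeight ω ρ a) :
    bmtWeight ω ρ a * R ^ i ≤ D * Real.exp (ω 1 / (A * ρ)) * bmtWeight ω (A * ρ) (a + i) := by
  have hA0 : 0 < A := by linarith
  have hD0 : 0 < D := by linarith
  have hkR : (0 : ℝ) < k := by exact_mod_cast hk
  have hmR : (0 : ℝ) < ((a + i : ℕ) : ℝ) := by exact_mod_cast hm
  have hθ : (i : ℝ) / k ≤ 1 := by rw [div_le_one hkR]; exact_mod_cast hik
  have hθ0 : 0 ≤ (i : ℝ) / k := by positivity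
  have hlogR : Real.log R = 1 / k * (Real.log D + 1 / ρ * youngConj ω (ρ * ((a + k : ℕ) : ℝ)) -
      1 / ρ * youngConj ω (ρ * a)) := by
    have := congrArg Real.log hRk
    rw [Real.log_pow, Real.log_div (by have := bmtWeight_pos ω ρ (a + k); positivity)
      (bmtWeight_pos ω ρ a).ne', Real.log_mul hD0.ne' (bmtWeight_pos _ _ _).ne'] at this
    unfold bmtWeight at this
    rw [Real.log_exp, Real.log_exp] at this
    rw [← this]; field_simp
  have hlogD : 0 ≤ Real.log D := Real.log_nonneg hD
  have hs : 0 < ρ * (A * ((a + i : ℕ) : ℝ)) := by positivity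
  have ka := youngConj_div_mono h (x := ρ * a) (by positivity) hs (by
    gcongr
    refine le_trans ?_ hb
    push_cast; linarith)
  have kb := youngConj_div_mono h (x := ρ * ((a + k : ℕ) : ℝ)) (by positivity) hs (by gcongr)
  -- Both endpoint values are bounded by one linear function through the origin. With weights `1 -
  -- i/k` and `i/k` this function is interpolated exactly, so its value at `ρ (a + i)` appears,
  -- which is `Y / A`.
  have key := add_le_add (mul_le_mul_of_nonneg_left ka (sub_nonneg.2 hθ))
    (mul_le_mul_of_nonneg_left kb hθ0)
  set Y := youngConj ω (ρ * (A * ((a + i : ℕ) : ℝ))) + ω 1 with hY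
  have e1 : (1 - (i : ℝ) / k) * (ρ * a / (ρ * (A * ((a + i : ℕ) : ℝ))) * Y) +
      (i : ℝ) / k * (ρ * ((a + k : ℕ) : ℝ) / (ρ * (A * ((a + i : ℕ) : ℝ))) * Y) = 1 / A * Y := by
    push_cast at hmR ⊢
    field_simp
    ring
  rw [e1] at key
  have hRi : R ^ i = Real.exp (i * Real.log R) := by
    rw [mul_comm, Real.exp_mul, Real.exp_log hR, Real.rpow_natCast]
  rw [show D * Real.exp (ω 1 / (A * ρ)) = Real.exp (Real.log D) * Real.exp (ω 1 / (A * ρ)) by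
    rw [Real.exp_log hD0]]
  unfold bmtWeight
  rw [hRi, ← Real.exp_add, ← Real.exp_add, ← Real.exp_add, Real.exp_le_exp, hlogR]
  have hω := h.nonneg 1 zero_le_one
  have key2 := mul_le_mul_of_nonneg_left key (one_div_pos.2 hρ).le
  have e2 : 1 / ρ * (1 / A * Y) =
      ω 1 / (A * ρ) + 1 / (A * ρ) * youngConj ω (A * ρ * ((a + i : ℕ) : ℝ)) := by
    rw [hY, show ρ * (A * ((a + i : ℕ) : ℝ)) = A * ρ * ((a + i : ℕ) : ℝ) by ring]
    field_simp; ring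
  rw [e2] at key2
  have e3 : (i : ℝ) / k * Real.log D ≤ Real.log D := mul_le_of_le_one_left hlogD hθ
  have e4 : 0 ≤ 1 / ρ * ω 1 := by positivity
  have e5 : (i : ℝ) * (1 / k * (Real.log D + 1 / ρ * youngConj ω (ρ * ((a + k : ℕ) : ℝ)) -
      1 / ρ * youngConj ω (ρ * a))) = (i : ℝ) / k * Real.log D + (i : ℝ) / k * (1 / ρ *
      youngConj ω (ρ * ((a + k : ℕ) : ℝ))) - (i : ℝ) / k * (1 / ρ * youngConj ω (ρ * a)) := by ring
  rw [e5]
  nlinarith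

theorem bmtWeight_factorial_aux (h : IsWeightFunction ω) {ρ δ ε M : ℝ} (hρ : 0 < ρ) (hδ : 0 < δ)
    (hδ1 : δ ≤ 1) (hε : ε * Real.exp 1 ≤ δ * ρ) (hω : ∀ t, 0 ≤ t → ω t ≤ ε * t + M) {k : ℕ}
    (hk : 1 ≤ k) : ((k : ℝ) / δ) ^ k ≤ Real.exp (M / ρ) * bmtWeight ω ρ k := by
  have hk0 : (1 : ℝ) ≤ k := by exact_mod_cast hk
  have hkd : 1 ≤ (k : ℝ) / δ := by rw [le_div_iff₀ hδ]; linarith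
  have hkd0 : 0 < (k : ℝ) / δ := by linarith
  -- The supremum is tested at `1 + log (k / δ)`, nonnegative since `δ ≤ 1`. The summand `1`
  -- contributes `ρ k`, which compensates the linear part of `ω (e k / δ)`.
  have h1 := h.le_youngConj (ρ * k) (t := 1 + Real.log (k / δ))
    (by have := Real.log_nonneg hkd; linarith)
  rw [Real.exp_add, Real.exp_log hkd0] at h1
  have h2 := hω (Real.exp 1 * (k / δ)) (by positivity)
  have h3 : ε * (Real.exp 1 * (k / δ)) ≤ ρ * k := by
    rw [show ε * (Real.exp 1 * (k / δ)) = (ε * Real.exp 1) * (k / δ) by ring,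
      show ρ * (k : ℝ) = (δ * ρ) * (k / δ) by field_simp]
    gcongr
  have h4 : ((k : ℝ) / δ) ^ k = Real.exp (k * Real.log (k / δ)) := by
    rw [mul_comm, Real.exp_mul, Real.exp_log hkd0, Real.rpow_natCast]
  unfold bmtWeight
  rw [h4, ← Real.exp_add, Real.exp_le_exp]
  have h5 : ρ * (k * Real.log (k / δ)) ≤ M + youngConj ω (ρ * k) := by nlinarith
  rw [show M / ρ + 1 / ρ * youngConj ω (ρ * k) = (M + youngConj ω (ρ * k)) / ρ by ring,
    le_div_iff₀ hρ]
  linarith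

theorem IsWeightFunction.exists_affine_bound (h : IsWeightFunction ω) {ε : ℝ} (hε : 0 ≤ ε)
    (hb : ∀ᶠ t in atTop, ‖ω t‖ ≤ ε * ‖t‖) : ∃ M, 0 ≤ M ∧ ∀ t, 0 ≤ t → ω t ≤ ε * t + M := by
  obtain ⟨T, hT⟩ := eventually_atTop.1 hb
  refine ⟨ω |T|, h.nonneg _ (abs_nonneg T), fun t ht => ?_⟩
  have hωT := h.nonneg _ (abs_nonneg T)
  rcases le_total T t with h1 | h1
  · have := hT t h1
    rw [Real.norm_of_nonneg (h.nonneg _ ht), Real.norm_of_nonneg ht] at this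
    linarith
  · have : ω t ≤ ω |T| := h.monotoneOn ht (abs_nonneg T) (h1.trans (le_abs_self T))
    have := mul_nonneg hε ht
    linarith

/-- The weights with parameter `ρ` dominate `(k / δ)^k`. -/
def DominatesFactorial (ω : ℝ → ℝ) (δ ρ : ℝ) : Prop :=
  ∃ D : ℝ, 1 ≤ D ∧ ∀ k : ℕ, 1 ≤ k → ((k : ℝ) / δ) ^ k ≤ D * bmtWeight ω ρ k

/-- A condition on the parameter which may be assumed without loss of generality: it holds for
large parameters in the Roumieu case, and for all parameters in the Beurling case. -/
def ClassType.Ample (τ : ClassType) (P : ℝ → Prop) : Prop :=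
  match τ with
  | .roumieu => ∃ ρ₀ : ℝ, ∀ ρ, ρ₀ ≤ ρ → 0 < ρ → P ρ
  | .beurling => ∀ ρ : ℝ, 0 < ρ → P ρ

theorem ClassType.Growth.ample {τ : ClassType} (h : IsWeightFunction ω) (hτ : τ.Growth ω) {δ : ℝ}
    (hδ : 0 < δ) (hδ1 : δ ≤ 1) : τ.Ample (DominatesFactorial ω δ) := by
  cases τ with
  | roumieu =>
    obtain ⟨c, hc0, hc⟩ := IsBigO.exists_nonneg hτ
    obtain ⟨M, hM, hb⟩ := h.exists_affine_bound hc0 hc.bound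
    refine ⟨c * Real.exp 1 / δ, fun ρ hρ0 hρ => ⟨Real.exp (M / ρ), ?_, fun k hk => ?_⟩⟩
    · exact Real.one_le_exp (by positivity)
    · refine bmtWeight_factorial_aux h hρ hδ hδ1 ?_ hb hk
      rw [div_le_iff₀ hδ] at hρ0
      linarith
  | beurling =>
    intro ρ hρ
    have hε : 0 < δ * ρ / Real.exp 1 := by positivity
    obtain ⟨M, hM, hb⟩ := h.exists_affine_bound hε.le (IsLittleO.bound hτ hε)
    refine ⟨Real.exp (M / ρ), Real.one_le_exp (by positivity), fun k hk => ?_⟩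
    exact bmtWeight_factorial_aux h hρ hδ hδ1 (by rw [div_mul_cancel₀ _ (Real.exp_pos 1).ne']) hb hk

/-- In the Roumieu case the given parameter is first enlarged until `G` holds, which `hP` permits;
in the Beurling case the hypothesis is used at `ρ / L`. -/
theorem ClassType.Param.transfer {τ : ClassType} {P Q G : ℝ → Prop} {L : ℝ} (hL : 0 < L)
    (hG : τ.Ample G) (hP : ∀ ρ ρ', 0 < ρ → ρ ≤ ρ' → P ρ → P ρ')
    (hPQ : ∀ ρ, 0 < ρ → G ρ → P ρ → Q (L * ρ)) (h : τ.Param P) : τ.Param Q := by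
  cases τ with
  | roumieu =>
    obtain ⟨ρ, hρ, hp⟩ := h
    obtain ⟨ρ₀, h0⟩ := hG
    have hm : 0 < max ρ ρ₀ := hρ.trans_le (le_max_left _ _)
    exact ⟨L * max ρ ρ₀, by positivity, hPQ _ hm (h0 _ (le_max_right _ _) hm)
      (hP _ _ hρ (le_max_left _ _) hp)⟩
  | beurling =>
    intro ρ hρ
    have := hPQ (ρ / L) (by positivity) (hG _ (by positivity)) (h _ (by positivity))
    rwa [mul_div_cancel₀ _ hL.ne'] at this

theorem ClassType.Param.transfer' {τ : ClassType} {P Q : ℝ → Prop} {L : ℝ} (hL : 0 < L)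
    (hPQ : ∀ ρ, 0 < ρ → P ρ → Q (L * ρ)) (h : τ.Param P) : τ.Param Q := by
  cases τ with
  | roumieu =>
    obtain ⟨ρ, hρ, hp⟩ := h
    exact ⟨L * ρ, by positivity, hPQ _ hρ hp⟩
  | beurling =>
    intro ρ hρ
    have := hPQ (ρ / L) (by positivity) (h _ (by positivity))
    rwa [mul_div_cancel₀ _ hL.ne'] at this

theorem ClassType.Param.mono {τ : ClassType} {P Q : ℝ → Prop}
    (hPQ : ∀ ρ, 0 < ρ → P ρ → Q ρ) (h : τ.Param P) : τ.Param Q :=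
  h.transfer' one_pos fun ρ hρ hp => by rw [one_mul]; exact hPQ ρ hρ hp

/-- Every positive integer lies in some `[k j, k (j + 1))`, whose right end is comparable. -/
theorem IsSpecialBaseSequence.exists_block {k : ℕ → ℕ} (hk : IsSpecialBaseSequence k) :
    ∃ A : ℝ, 1 ≤ A ∧ ∀ m : ℕ, 0 < m → ∃ j, k j ≤ m ∧ m < k (j + 1) ∧
      (k (j + 1) : ℝ) ≤ A * m := by
  obtain ⟨⟨h0, hmono⟩, A, hA⟩ := hk
  refine ⟨max 1 (max A (k 1)), le_max_left _ _, fun m hm => ?_⟩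
  set B := max 1 (max A (k 1))
  have hB : 0 ≤ B := zero_le_one.trans (le_max_left _ _)
  have hex : ∃ j, m < k j := ⟨m + 1, (Nat.lt_succ_self m).trans_le (hmono.id_le (m + 1))⟩
  classical
  obtain ⟨j, hj⟩ : ∃ j, Nat.find hex = j + 1 := by
    refine Nat.exists_eq_succ_of_ne_zero fun h => ?_
    have := Nat.find_spec hex
    rw [h, h0] at this
    omega
  have h1 : m < k (j + 1) := hj ▸ Nat.find_spec hex
  have h2 : k j ≤ m := not_lt.1 (Nat.find_min hex (by omega))
  refine ⟨j, h2, h1, ?_⟩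
  have hm1 : (1 : ℝ) ≤ m := by exact_mod_cast hm
  -- In the first block the quotient `k 1 / k 0` carries no information, but `m ≥ 1` makes the
  -- constant `k 1` sufficient.
  rcases Nat.eq_zero_or_pos j with rfl | hj0
  · have : (k 1 : ℝ) ≤ B := (le_max_right _ _).trans (le_max_right _ _)
    calc (k (0 + 1) : ℝ) ≤ B := this
      _ = B * 1 := (mul_one B).symm
      _ ≤ B * m := by gcongr
  · have hkj : 0 < k j := by have := hmono hj0; omega
    have hkj' : (0 : ℝ) < k j := by exact_mod_cast hkj
    have := (div_le_iff₀ hkj').1 (hA j hj0)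
    have hAB : A ≤ B := (le_max_left _ _).trans (le_max_right _ _)
    calc (k (j + 1) : ℝ) ≤ A * k j := this
      _ ≤ B * k j := by gcongr
      _ ≤ B * m := by gcongr

end Weights

/-! ### Derivatives in one variable from equispaced values. -/

section OneDim

theorem prod_abs_sub_range_erase {l M : ℕ} (h : l ≤ M) :
    ∏ j ∈ (Finset.range (M + 1)).erase l, |(l : ℝ) - j| = l.factorial * (M - l).factorial := by
  induction M, h using Nat.le_induction with
  | base =>
    have : (Finset.range (l + 1)).erase l = Finset.range l := by
      ext x; simp only [Finset.mem_erase, Finset.mem_range]; omega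
    rw [this, Nat.sub_self, Nat.factorial_zero, Nat.cast_one, mul_one,
      ← Finset.prod_range_reflect, ← Finset.prod_range_add_one_eq_factorial, Nat.cast_prod]
    refine Finset.prod_congr rfl fun j hj => ?_
    have hj' := Finset.mem_range.1 hj
    have : (l : ℝ) - ((l - 1 - j : ℕ) : ℝ) = (j + 1 : ℕ) := by
      have : l = (l - 1 - j) + (j + 1) := by omega
      nth_rewrite 1 [this]
      push_cast; ring
    rw [this, abs_of_nonneg (Nat.cast_nonneg _)]
  | succ M hM ih =>
    have : (Finset.range (M + 1 + 1)).erase l = insert (M + 1) ((Finset.range (M + 1)).erase l) := by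
      ext x; simp only [Finset.mem_erase, Finset.mem_range, Finset.mem_insert]; omega
    rw [this, Finset.prod_insert (by simp), ih, show M + 1 - l = (M - l) + 1 by omega,
      Nat.factorial_succ, abs_sub_comm, abs_of_nonneg (by
        rw [sub_nonneg]; exact_mod_cast (by omega : l ≤ M + 1))]
    push_cast [Nat.cast_sub hM]
    ring

/-- A discrete formula for the Taylor coefficient of order `c` of polynomials of degree less
than `N`, with exponentially bounded weights. -/
theorem exists_weights_coeff {c N : ℕ} (hc : c < N) :
    ∃ a : ℕ → ℝ, (∀ l < N, |a l| ≤ (4 * Real.exp 1) ^ N) ∧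
      ∀ q < N, ∑ l ∈ Finset.range N, a l * ((l : ℝ) / N) ^ q = if q = c then 1 else 0 := by
  have hN : 0 < N := by omega
  have hNR : (0 : ℝ) < N := by exact_mod_cast hN
  set v : ℕ → ℝ := fun l => (l : ℝ) / N with hv
  have hvs : Set.InjOn v (Finset.range N) := by
    intro x _ y _ hxy
    simp only [hv] at hxy
    rw [div_left_inj' hNR.ne'] at hxy
    exact_mod_cast hxy
  -- The weight `a l` is the coefficient of `X ^ c` in the `l`-th Lagrange basis polynomial for the
  -- nodes `l / N`: an elementary symmetric function of degree `N - 1 - c` of the other negated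
  -- nodes over the product of differences.
  refine ⟨fun l => (∑ t ∈ ((Finset.range N).erase l).powersetCard (N - (c + 1)),
    ∏ a ∈ t, (0 - v a)) / ∏ j ∈ (Finset.range N).erase l, (v l - v j), fun l hl => ?_,
    fun q hq => ?_⟩
  · obtain ⟨M, rfl⟩ : ∃ M, N = M + 1 := ⟨N - 1, by omega⟩
    have hcard : ((Finset.range (M + 1)).erase l).card = M := by
      rw [Finset.card_erase_of_mem (Finset.mem_range.2 hl)]; simp
    have h1 : |∑ t ∈ ((Finset.range (M + 1)).erase l).powersetCard (M + 1 - (c + 1)),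
        ∏ a ∈ t, (0 - v a)| ≤ 2 ^ M := by
      calc _ ≤ ∑ t ∈ ((Finset.range (M + 1)).erase l).powersetCard (M + 1 - (c + 1)),
            |∏ a ∈ t, (0 - v a)| := Finset.abs_sum_le_sum_abs _ _
        _ ≤ ∑ t ∈ ((Finset.range (M + 1)).erase l).powersetCard (M + 1 - (c + 1)), (1 : ℝ) := by
          refine Finset.sum_le_sum fun t ht => ?_
          rw [Finset.abs_prod]
          refine Finset.prod_le_one (fun _ _ => abs_nonneg _) fun i hi => ?_
          have hi' : i < M + 1 := by
            have := (Finset.mem_powersetCard.1 ht).1 hi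
            exact Finset.mem_range.1 (Finset.mem_of_mem_erase this)
          rw [zero_sub, abs_neg, abs_of_nonneg (by positivity), hv]
          simp only
          rw [div_le_one hNR]
          exact_mod_cast hi'.le
        _ = (Nat.choose M (M + 1 - (c + 1)) : ℝ) := by
          rw [Finset.sum_const, Finset.card_powersetCard, hcard]; simp
        _ ≤ 2 ^ M := by exact_mod_cast Nat.choose_le_two_pow M _
    have h2 : |∏ j ∈ (Finset.range (M + 1)).erase l, (v l - v j)| =
        l.factorial * (M - l).factorial / ((M + 1 : ℕ) : ℝ) ^ M := by
      rw [Finset.abs_prod, ← prod_abs_sub_range_erase (by omega : l ≤ M)]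
      have : ∀ j, |v l - v j| = |(l : ℝ) - j| / ((M + 1 : ℕ) : ℝ) := by
        intro j
        rw [hv]; simp only
        rw [← sub_div, abs_div, abs_of_pos hNR]
      simp only [this]
      rw [Finset.prod_div_distrib, Finset.prod_const, hcard]
    rw [abs_div, h2]
    -- The reciprocal of the denominator is `choose M l * N ^ M / M!`; the binomial coefficient
    -- costs `2 ^ M` and the rest at most `e ^ N`. The numerator contributes another `2 ^ M`.
    have h3 : ((M + 1 : ℕ) : ℝ) ^ M / M.factorial ≤ Real.exp 1 ^ (M + 1) := by
      have := Real.pow_div_factorial_le_exp ((M + 1 : ℕ) : ℝ) (by positivity) M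
      rwa [← mul_one ((M + 1 : ℕ) : ℝ), Real.exp_nat_mul, mul_one] at this
    have h4 : (Nat.choose M l : ℝ) ≤ 2 ^ M := by exact_mod_cast Nat.choose_le_two_pow M l
    have h5 : (Nat.choose M l : ℝ) * (l.factorial * (M - l).factorial) = M.factorial := by
      rw [← Nat.choose_mul_factorial_mul_factorial (by omega : l ≤ M)]; push_cast; ring
    have hf1 : (0 : ℝ) < l.factorial := by positivity
    have hf2 : (0 : ℝ) < (M - l).factorial := by positivity
    have hf3 : (0 : ℝ) < M.factorial := by positivity
    have h6 : ((M + 1 : ℕ) : ℝ) ^ M / (l.factorial * (M - l).factorial) =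
        Nat.choose M l * (((M + 1 : ℕ) : ℝ) ^ M / M.factorial) := by
      rw [← h5]
      have : (0 : ℝ) < Nat.choose M l := by exact_mod_cast Nat.choose_pos (by omega : l ≤ M)
      field_simp
    calc _ ≤ 2 ^ M / (l.factorial * (M - l).factorial / ((M + 1 : ℕ) : ℝ) ^ M) := by gcongr
      _ = 2 ^ M * (((M + 1 : ℕ) : ℝ) ^ M / (l.factorial * (M - l).factorial)) := by field_simp
      _ ≤ 2 ^ M * (2 ^ M * Real.exp 1 ^ (M + 1)) := by rw [h6]; gcongr
      _ = 4 ^ M * Real.exp 1 ^ (M + 1) := by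
        rw [← mul_assoc, ← mul_pow]; norm_num
      _ ≤ 4 ^ (M + 1) * Real.exp 1 ^ (M + 1) := by gcongr <;> norm_num
      _ = _ := by rw [mul_pow]
  · have key := Lagrange.eval_iterate_derivative_eq_sum (s := Finset.range N) (v := v) hvs
      (P := Polynomial.X ^ q) (by
        rw [Polynomial.degree_X_pow, Finset.card_range]; exact_mod_cast hq)
      (k := c) (by simpa using hc) 0
    rw [Finset.card_range] at key
    have hfac : (c.factorial : ℝ) ≠ 0 := by positivity
    have e1 : ∑ l ∈ Finset.range N, (∑ t ∈ ((Finset.range N).erase l).powersetCard (N - (c + 1)),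
        ∏ a ∈ t, (0 - v a)) / (∏ j ∈ (Finset.range N).erase l, (v l - v j)) * ((l : ℝ) / N) ^ q =
        ∑ l ∈ Finset.range N, (Polynomial.eval (v l) (Polynomial.X ^ q) /
          ∏ j ∈ (Finset.range N).erase l, (v l - v j)) *
          ∑ t ∈ ((Finset.range N).erase l).powersetCard (N - (c + 1)), ∏ a ∈ t, (0 - v a) := by
      refine Finset.sum_congr rfl fun l _ => ?_
      rw [Polynomial.eval_pow, Polynomial.eval_X]
      ring
    rw [e1, ← mul_right_inj' hfac, ← key, Polynomial.iterate_derivative_X_pow_eq_smul]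
    rcases lt_trichotomy q c with h | h | h
    · rw [if_neg h.ne, Nat.descFactorial_eq_zero_iff_lt.2 h]; simp
    · subst h; simp [Nat.descFactorial_self]
    · rw [if_neg h.ne']
      simp [zero_pow (by omega : q - c ≠ 0)]

variable {E : Type*} [NormedAddCommGroup E] [NormedSpace ℝ E]

/-- Taylor's formula with a bound of the remainder by the `L¹` norm of the last derivative. -/
theorem norm_sub_taylor_le [CompleteSpace E] {h : ℝ} (N : ℕ) :
    ∀ (φ : ℕ → ℝ → E), (∀ q t, HasDerivAt (φ q) (φ (q + 1) t) t) → ∀ t ∈ Icc 0 h,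
    ‖φ 0 t - ∑ q ∈ Finset.range (N + 1), (t ^ q / q.factorial) • φ q 0‖ ≤
      t ^ N / N.factorial * ∫ s in (0 : ℝ)..h, ‖φ (N + 1) s‖ := by
  induction N with
  | zero =>
    intro φ hφ t ht
    have hcont : ∀ q, Continuous (φ q) := fun q =>
      continuous_iff_continuousAt.2 fun t => (hφ q t).continuousAt
    have := intervalIntegral.integral_eq_sub_of_hasDerivAt (a := 0) (b := t)
      (fun x _ => hφ 0 x) ((hcont 1).intervalIntegrable _ _)
    simp only [zero_add, Finset.range_one, Finset.sum_singleton, pow_zero, Nat.factorial_zero,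
      Nat.cast_one, div_one, one_smul, one_mul]
    rw [← this]
    refine (intervalIntegral.norm_integral_le_integral_norm ht.1).trans ?_
    exact intervalIntegral.integral_mono_interval le_rfl ht.1 ht.2
      (Eventually.of_forall fun _ => norm_nonneg _) ((hcont 1).norm.intervalIntegrable _ _)
  | succ N ih =>
    intro φ hφ t ht
    set I := ∫ s in (0 : ℝ)..h, ‖φ (N + 1 + 1) s‖ with hI
    -- The remainder is the integral of the lower-order Taylor remainder of the derivative `φ 1`.
    have ih' := ih (fun q => φ (q + 1)) (fun q t => hφ (q + 1) t)
    have hderiv : ∀ s : ℝ, HasDerivAt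
        (fun s => φ 0 s - ∑ q ∈ Finset.range (N + 1 + 1), (s ^ q / q.factorial) • φ q 0)
        (φ 1 s - ∑ q ∈ Finset.range (N + 1), (s ^ q / q.factorial) • φ (q + 1) 0) s := by
      intro s
      refine (hφ 0 s).sub ?_
      simp_rw [Finset.sum_range_succ' _ (N + 1)]
      simp only [pow_zero, Nat.factorial_zero, Nat.cast_one, div_one, one_smul]
      refine HasDerivAt.add_const _ (HasDerivAt.fun_sum fun q _ => ?_)
      refine HasDerivAt.smul_const ?_ _
      have := (hasDerivAt_pow (q + 1) s).div_const ((q + 1).factorial : ℝ)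
      convert this using 1
      rw [Nat.factorial_succ]
      push_cast
      field_simp
    have hcont : ∀ q, Continuous (φ q) := fun q =>
      continuous_iff_continuousAt.2 fun t => (hφ q t).continuousAt
    have hc' : Continuous fun s : ℝ =>
        φ 1 s - ∑ q ∈ Finset.range (N + 1), (s ^ q / q.factorial) • φ (q + 1) 0 := by
      have := hcont 1
      fun_prop
    have hftc := intervalIntegral.integral_eq_sub_of_hasDerivAt (a := 0) (b := t)
      (fun x _ => hderiv x) (hc'.intervalIntegrable _ _)
    have hz : φ 0 0 - ∑ q ∈ Finset.range (N + 1 + 1), ((0 : ℝ) ^ q / q.factorial) • φ q 0 = 0 := by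
      rw [Finset.sum_range_succ']
      simp
    rw [hz, sub_zero] at hftc
    rw [← hftc]
    calc _ ≤ ∫ s in (0 : ℝ)..t,
          ‖φ 1 s - ∑ q ∈ Finset.range (N + 1), (s ^ q / q.factorial) • φ (q + 1) 0‖ :=
          intervalIntegral.norm_integral_le_integral_norm ht.1
      _ ≤ ∫ s in (0 : ℝ)..t, s ^ N / N.factorial * I := by
          refine intervalIntegral.integral_mono_on ht.1 (hc'.norm.intervalIntegrable _ _)
            (Continuous.intervalIntegrable (by fun_prop) _ _) fun s hs => ?_
          exact ih' s ⟨hs.1, hs.2.trans ht.2⟩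
      _ = t ^ (N + 1) / (N + 1).factorial * I := by
          rw [intervalIntegral.integral_mul_const, intervalIntegral.integral_div, integral_pow,
            Nat.factorial_succ]
          push_cast
          simp
          left
          field_simp

/-- The discrete formula is exact on the Taylor polynomial of degree below `N`. Replacing the
polynomial by `φ 0` at the nodes costs the Taylor remainder, kept as an `L¹` integral so that it can
be averaged in `L^p` later. -/
theorem norm_deriv_le [CompleteSpace E] {h : ℝ} (hh : 0 < h) {c N : ℕ} (hc : c < N)
    (φ : ℕ → ℝ → E) (hφ : ∀ q t, HasDerivAt (φ q) (φ (q + 1) t) t) :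
    ‖φ c 0‖ ≤ c.factorial / h ^ c * (4 * Real.exp 1) ^ N *
      (∑ l ∈ Finset.range N, ‖φ 0 (h * (l / N))‖ +
        N * (h ^ (N - 1) / (N - 1).factorial) * ∫ s in (0 : ℝ)..h, ‖φ N s‖) := by
  obtain ⟨a, ha, hsum⟩ := exists_weights_coeff hc
  obtain ⟨M, rfl⟩ : ∃ M, N = M + 1 := ⟨N - 1, by omega⟩
  set N := M + 1 with hN
  have hNR : (0 : ℝ) < N := by simp only [hN]; positivity
  set I := ∫ s in (0 : ℝ)..h, ‖φ N s‖ with hI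
  have hI0 : 0 ≤ I := intervalIntegral.integral_nonneg hh.le fun _ _ => norm_nonneg _
  set P : ℝ → E := fun t => ∑ q ∈ Finset.range N, (t ^ q / q.factorial) • φ q 0 with hP
  have e1 : ∑ l ∈ Finset.range N, a l • P (h * (l / N)) = (h ^ c / c.factorial) • φ c 0 := by
    simp only [hP, Finset.smul_sum, smul_smul]
    rw [Finset.sum_comm]
    have : ∀ q ∈ Finset.range N, ∑ l ∈ Finset.range N,
        (a l * ((h * (l / N : ℝ)) ^ q / q.factorial)) • φ q 0 =
        if q = c then (h ^ q / q.factorial) • φ q 0 else 0 := by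
      intro q hq
      rw [← Finset.sum_smul]
      have e2 : ∑ l ∈ Finset.range N, a l * ((h * (l / N : ℝ)) ^ q / q.factorial) =
          h ^ q / q.factorial * ∑ l ∈ Finset.range N, a l * ((l : ℝ) / N) ^ q := by
        rw [Finset.mul_sum]
        refine Finset.sum_congr rfl fun l _ => ?_
        rw [mul_pow]; ring
      rw [e2, hsum q (Finset.mem_range.1 hq)]
      split_ifs <;> simp
    rw [Finset.sum_congr rfl this, Finset.sum_ite_eq', if_pos (Finset.mem_range.2 hc)]
  have hbound : ∀ l ∈ Finset.range N, ‖a l • P (h * (l / N))‖ ≤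
      (4 * Real.exp 1) ^ N * (‖φ 0 (h * (l / N))‖ + h ^ M / M.factorial * I) := by
    intro l hl
    have hl' : (l : ℝ) / N ≤ 1 := by
      rw [div_le_one hNR]; exact_mod_cast (Finset.mem_range.1 hl).le
    have ht0 : 0 ≤ h * ((l : ℝ) / N) := by positivity
    have ht1 : h * ((l : ℝ) / N) ≤ h := mul_le_of_le_one_right hh.le hl'
    have h1 := norm_sub_taylor_le M φ hφ _ ⟨ht0, ht1⟩
    have h2 : (h * ((l : ℝ) / N)) ^ M / M.factorial * I ≤ h ^ M / M.factorial * I := by gcongr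
    rw [norm_smul, Real.norm_eq_abs]
    refine mul_le_mul (ha l (Finset.mem_range.1 hl)) ?_ (norm_nonneg _) (by positivity)
    have h3 : ‖P (h * (l / N))‖ ≤ ‖φ 0 (h * (l / N))‖ + ‖φ 0 (h * (l / N)) - P (h * (l / N))‖ := by
      have := norm_sub_le (φ 0 (h * (l / N))) (φ 0 (h * (l / N)) - P (h * (l / N)))
      rwa [sub_sub_cancel] at this
    linarith [h3, h1, h2]
  have h4 : ‖(h ^ c / c.factorial) • φ c 0‖ ≤ (4 * Real.exp 1) ^ N *
      (∑ l ∈ Finset.range N, ‖φ 0 (h * (l / N))‖ + N * (h ^ M / M.factorial) * I) := by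
    rw [← e1]
    refine (norm_sum_le_of_le _ hbound).trans (le_of_eq ?_)
    rw [← Finset.mul_sum, Finset.sum_add_distrib, Finset.sum_const, Finset.card_range, nsmul_eq_mul,
      mul_assoc]
  have hpos : 0 < h ^ c / c.factorial := by positivity
  rw [norm_smul, Real.norm_of_nonneg hpos.le, mul_comm, ← le_div_iff₀ hpos] at h4
  refine h4.trans (le_of_eq ?_)
  rw [show N - 1 = M by omega]
  field_simp

end OneDim

/-! ### Passage to `L^p` norms. -/

section LpBounds

variable {n : ℕ} {E : Type*} [NormedAddCommGroup E] {p : ℝ≥0∞}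
  {S S' : Set (EuclideanSpace ℝ (Fin n))}

theorem eLpNorm_translate_le (hS' : MeasurableSet S') {v : EuclideanSpace ℝ (Fin n)}
    (hv : ∀ x ∈ S, x + v ∈ S') {G : EuclideanSpace ℝ (Fin n) → E}
    (hG : Continuous G) :
    eLpNorm (fun x => G (x + v)) p (volume.restrict S) ≤ eLpNorm G p (volume.restrict S') := by
  have hmp : MeasurePreserving (fun x => x + v) (volume.restrict ((fun x => x + v) ⁻¹' S'))
      (volume.restrict S') :=
    (measurePreserving_add_right volume v).restrict_preimage hS'
  calc _ ≤ eLpNorm (fun x => G (x + v)) p (volume.restrict ((fun x => x + v) ⁻¹' S')) :=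
        eLpNorm_mono_measure _ (Measure.restrict_mono (fun x hx => hv x hx) le_rfl)
    _ = _ := eLpNorm_comp_measurePreserving hG.aestronglyMeasurable hmp

/-- By continuity, exceeding the essential supremum at one point means exceeding it on a nonempty
open set, which has positive measure. -/
theorem enorm_le_eLpNorm_top (hS : IsOpen S) {G : EuclideanSpace ℝ (Fin n) → E}
    (hG : Continuous G) {x : EuclideanSpace ℝ (Fin n)} (hx : x ∈ S) :
    ‖G x‖ₑ ≤ eLpNorm G ∞ (volume.restrict S) := by
  rw [eLpNorm_exponent_top]
  by_contra hcon
  push Not at hcon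
  have hopen : IsOpen (S ∩ {y | eLpNormEssSup G (volume.restrict S) < ‖G y‖ₑ}) :=
    hS.inter (isOpen_lt continuous_const hG.enorm)
  have hpos : 0 < volume (S ∩ {y | eLpNormEssSup G (volume.restrict S) < ‖G y‖ₑ}) :=
    hopen.measure_pos _ ⟨x, hx, hcon⟩
  have hae := ae_le_eLpNormEssSup (f := G) (μ := volume.restrict S)
  rw [ae_restrict_iff' hS.measurableSet, ae_iff] at hae
  refine hpos.ne' (measure_mono_null ?_ hae)
  rintro y ⟨hy1, hy2⟩
  simp only [Set.mem_ofPred_eq, Classical.not_imp, not_le]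
  exact ⟨hy1, hy2⟩

/-- This is Minkowski's integral inequality for translates: for finite `p`, Hölder in `t`, then
Tonelli and translation invariance; for `p = ∞`, a pointwise bound. -/
theorem eLpNorm_average_le (hp : 1 ≤ p) (hS : IsOpen S) (hS' : IsOpen S') {h : ℝ} (hh : 0 < h)
    {v : EuclideanSpace ℝ (Fin n)} (hv : ∀ x ∈ S, ∀ t ∈ Icc 0 h, x + t • v ∈ S')
    {G : EuclideanSpace ℝ (Fin n) → E} (hG : Continuous G) :
    eLpNorm (fun x => ∫ t in (0 : ℝ)..h, ‖G (x + t • v)‖) p (volume.restrict S) ≤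
      ENNReal.ofReal h * eLpNorm G p (volume.restrict S') := by
  set ν : Measure ℝ := volume.restrict (Ioc 0 h) with hν
  have hνu : ν univ = ENNReal.ofReal h := by simp [hν]
  have hint : ∀ x, ‖∫ t in (0 : ℝ)..h, ‖G (x + t • v)‖‖ₑ = ∫⁻ t, ‖G (x + t • v)‖ₑ ∂ν := by
    intro x
    rw [intervalIntegral.integral_of_le hh.le]
    rw [Real.enorm_eq_ofReal (integral_nonneg fun _ => norm_nonneg _),
      ofReal_integral_norm_eq_lintegral_enorm]
    have : Continuous fun t : ℝ => G (x + t • v) := by fun_prop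
    exact (this.integrableOn_Icc (a := 0) (b := h)).mono_set Ioc_subset_Icc_self
  have hmem : ∀ᵐ t ∂ν, t ∈ Icc 0 h := by
    filter_upwards [ae_restrict_mem measurableSet_Ioc] with t ht using Ioc_subset_Icc_self ht
  rcases eq_or_ne p ∞ with rfl | hp'
  · rw [eLpNorm_exponent_top (f := fun x => ∫ t in (0 : ℝ)..h, ‖G (x + t • v)‖)]
    refine eLpNormEssSup_le_of_ae_enorm_bound ?_
    filter_upwards [ae_restrict_mem hS.measurableSet] with x hx
    rw [hint x]
    calc ∫⁻ t, ‖G (x + t • v)‖ₑ ∂ν ≤ ∫⁻ t, eLpNorm G ∞ (volume.restrict S') ∂ν := by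
          refine lintegral_mono_ae ?_
          filter_upwards [hmem] with t ht
          exact enorm_le_eLpNorm_top hS' hG (hv x hx t ht)
      _ = _ := by rw [lintegral_const, hνu, mul_comm]
  · have hp0 : p ≠ 0 := (zero_lt_one.trans_le hp).ne'
    set r := p.toReal with hr
    have hr1 : 1 ≤ r := by
      rw [hr, ← ENNReal.toReal_one]
      exact ENNReal.toReal_mono hp' hp
    have hr0 : 0 < r := by linarith
    have hcontG : Continuous fun z : EuclideanSpace ℝ (Fin n) × ℝ => ‖G (z.1 + z.2 • v)‖ₑ ^ r :=
      (ENNReal.continuous_rpow_const).comp (hG.comp (by fun_prop)).enorm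
    have hjensen : ∀ x, (∫⁻ t, ‖G (x + t • v)‖ₑ ∂ν) ^ r ≤
        ENNReal.ofReal h ^ (r - 1) * ∫⁻ t, ‖G (x + t • v)‖ₑ ^ r ∂ν := by
      intro x
      have hc : Continuous fun t : ℝ => G (x + t • v) := by fun_prop
      have h1 := eLpNorm_le_eLpNorm_mul_rpow_measure_univ (μ := ν) hp hc.aestronglyMeasurable
      rw [eLpNorm_one_eq_lintegral_enorm, eLpNorm_eq_lintegral_rpow_enorm_toReal hp0 hp', hνu]
        at h1
      refine (ENNReal.rpow_le_rpow h1 hr0.le).trans (le_of_eq ?_)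
      rw [ENNReal.mul_rpow_of_nonneg _ _ hr0.le, ← ENNReal.rpow_mul, ← ENNReal.rpow_mul, mul_comm,
        ← hr, one_div_mul_cancel hr0.ne', ENNReal.rpow_one]
      congr 2
      rw [ENNReal.toReal_one]
      field_simp
    rw [eLpNorm_eq_lintegral_rpow_enorm_toReal hp0 hp', eLpNorm_eq_lintegral_rpow_enorm_toReal hp0 hp']
    simp_rw [hint]
    rw [← hr]
    have htrans : ∀ t ∈ Icc 0 h, ∫⁻ x, ‖G (x + t • v)‖ₑ ^ r ∂(volume.restrict S) ≤
        ∫⁻ x, ‖G x‖ₑ ^ r ∂(volume.restrict S') := by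
      intro t ht
      have := eLpNorm_translate_le (p := p) hS'.measurableSet (v := t • v)
        (fun x hx => hv x hx t ht) hG
      rw [eLpNorm_eq_lintegral_rpow_enorm_toReal hp0 hp',
        eLpNorm_eq_lintegral_rpow_enorm_toReal hp0 hp', ← hr] at this
      exact (ENNReal.rpow_le_rpow_iff (by positivity)).1 this
    have hmain : ∫⁻ x, (∫⁻ t, ‖G (x + t • v)‖ₑ ∂ν) ^ r ∂(volume.restrict S) ≤
        ENNReal.ofReal h ^ r * ∫⁻ x, ‖G x‖ₑ ^ r ∂(volume.restrict S') := by
      calc _ ≤ ∫⁻ x, ENNReal.ofReal h ^ (r - 1) * ∫⁻ t, ‖G (x + t • v)‖ₑ ^ r ∂ν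
            ∂(volume.restrict S) := lintegral_mono hjensen
        _ = ENNReal.ofReal h ^ (r - 1) * ∫⁻ x, ∫⁻ t, ‖G (x + t • v)‖ₑ ^ r ∂ν
            ∂(volume.restrict S) :=
            lintegral_const_mul' _ _ (ENNReal.rpow_ne_top_of_nonneg (by linarith) (by simp))
        _ = ENNReal.ofReal h ^ (r - 1) * ∫⁻ t, ∫⁻ x, ‖G (x + t • v)‖ₑ ^ r
            ∂(volume.restrict S) ∂ν := by
            rw [lintegral_lintegral_swap]
            exact hcontG.measurable.aemeasurable
        _ ≤ ENNReal.ofReal h ^ (r - 1) * ∫⁻ t, ∫⁻ x, ‖G x‖ₑ ^ r ∂(volume.restrict S') ∂ν := by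
            refine mul_le_mul_right (lintegral_mono_ae ?_) _
            filter_upwards [hmem] with t ht using htrans t ht
        _ = _ := by
            have hh' : ENNReal.ofReal h ≠ 0 := by simpa using hh
            rw [lintegral_const, hνu, mul_comm (∫⁻ x, ‖G x‖ₑ ^ r ∂(volume.restrict S')), ← mul_assoc]
            nth_rewrite 2 [← ENNReal.rpow_one (ENNReal.ofReal h)]
            rw [← ENNReal.rpow_add _ _ hh' ENNReal.ofReal_ne_top, sub_add_cancel]
    refine (ENNReal.rpow_le_rpow hmain (by positivity : 0 ≤ 1 / r)).trans (le_of_eq ?_)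
    rw [ENNReal.mul_rpow_of_nonneg _ _ (by positivity), ← ENNReal.rpow_mul,
      mul_one_div_cancel hr0.ne', ENNReal.rpow_one]

theorem eLpNorm_deriv_le [NormedSpace ℝ E] [CompleteSpace E] (hp : 1 ≤ p) (hS : IsOpen S)
    (hS' : IsOpen S') {h : ℝ} (hh : 0 < h) {v : EuclideanSpace ℝ (Fin n)}
    (hv : ∀ x ∈ S, ∀ t ∈ Icc 0 h, x + t • v ∈ S') (F : ℕ → EuclideanSpace ℝ (Fin n) → E)
    (hF : ∀ q, Continuous (F q))
    (hD : ∀ q x t, HasDerivAt (fun t : ℝ => F q (x + t • v)) (F (q + 1) (x + t • v)) t)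
    {c N : ℕ} (hc : c ≤ N) {A B : ℝ} (hA : 0 ≤ A) (hB : 0 ≤ B)
    (hFA : eLpNorm (F 0) p (volume.restrict S') ≤ ENNReal.ofReal A)
    (hFB : eLpNorm (F N) p (volume.restrict S') ≤ ENNReal.ofReal B) :
    eLpNorm (F c) p (volume.restrict S) ≤ ENNReal.ofReal ((16 * Real.exp 1) ^ N *
      (c.factorial / h ^ c * A + h ^ (N - c) / (N - c).factorial * B)) := by
  have he : 1 ≤ Real.exp 1 := Real.one_le_exp zero_le_one
  rcases hc.eq_or_lt with rfl | hc
  -- For `c = N` the discrete formula does not apply, but the bound `B` is available at once because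
  -- `S ⊆ S'`, by the translation with `t = 0`.
  · have h1 : eLpNorm (F c) p (volume.restrict S) ≤ ENNReal.ofReal B := by
      refine le_trans (eLpNorm_mono_measure _ (Measure.restrict_mono (fun x hx => ?_) le_rfl)) hFB
      simpa using hv x hx 0 ⟨le_rfl, hh.le⟩
    refine h1.trans (ENNReal.ofReal_le_ofReal ?_)
    have h2 : 1 ≤ (16 * Real.exp 1) ^ c := one_le_pow₀ (by linarith)
    have h3 : 0 ≤ c.factorial / h ^ c * A := by positivity
    simp only [Nat.sub_self, pow_zero, Nat.factorial_zero, Nat.cast_one, div_one, one_mul]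
    nlinarith
  · obtain ⟨M, rfl⟩ : ∃ M, N = M + 1 := ⟨N - 1, by omega⟩
    set N := M + 1 with hN
    set μ := volume.restrict S with hμ
    set κ : ℝ := N * (h ^ (N - 1) / (N - 1).factorial) with hκ
    have hκ0 : 0 ≤ κ := by positivity
    set C : ℝ := c.factorial / h ^ c * (4 * Real.exp 1) ^ N with hC
    have hC0 : 0 ≤ C := by positivity
    set J : EuclideanSpace ℝ (Fin n) → ℝ := fun x => ∫ t in (0 : ℝ)..h, ‖F N (x + t • v)‖ with hJ
    have hJc : Continuous J := by
      refine intervalIntegral.continuous_parametric_intervalIntegral_of_continuous' ?_ 0 h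
      have := hF N
      simp only [Function.uncurry_def]
      fun_prop
    set T : ℕ → EuclideanSpace ℝ (Fin n) → ℝ := fun l x => ‖F 0 (x + (h * (l / N : ℝ)) • v)‖ with hT
    have hTc : ∀ l, Continuous (T l) := fun l => by
      have := hF 0
      simp only [hT]
      fun_prop
    have hpt : ∀ x, ‖F c x‖ ≤ C * ((∑ l ∈ Finset.range N, T l) + κ • J) x := by
      intro x
      have := norm_deriv_le hh hc (fun q t => F q (x + t • v)) (fun q t => hD q x t)
      simpa only [zero_smul, add_zero, Pi.add_apply, Finset.sum_apply, Pi.smul_apply,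
        smul_eq_mul] using this
    have hTl : ∀ l ∈ Finset.range N, eLpNorm (T l) p μ ≤ ENNReal.ofReal A := by
      intro l hl
      refine le_trans ?_ hFA
      simp only [hT]
      rw [eLpNorm_norm (fun x => F 0 (x + (h * (l / N : ℝ)) • v))]
      refine eLpNorm_translate_le hS'.measurableSet (fun x hx => hv x hx _ ⟨by positivity, ?_⟩)
        (hF 0)
      refine mul_le_of_le_one_right hh.le ?_
      rw [div_le_one (by positivity)]
      exact_mod_cast (Finset.mem_range.1 hl).le
    have hJl : eLpNorm J p μ ≤ ENNReal.ofReal (h * B) := by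
      rw [ENNReal.ofReal_mul hh.le]
      refine (eLpNorm_average_le hp hS hS' hh hv (hF N)).trans ?_
      gcongr
    have hsum : eLpNorm ((∑ l ∈ Finset.range N, T l) + κ • J) p μ ≤
        ENNReal.ofReal (N * A + κ * (h * B)) := by
      rw [ENNReal.ofReal_add (by positivity) (by positivity)]
      refine (eLpNorm_add_le (Finset.aestronglyMeasurable_sum _ fun l _ =>
        (hTc l).aestronglyMeasurable) (hJc.const_smul κ).aestronglyMeasurable hp).trans ?_
      gcongr
      · refine (eLpNorm_sum_le (fun l _ => (hTc l).aestronglyMeasurable) hp).trans ?_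
        refine (Finset.sum_le_sum hTl).trans (le_of_eq ?_)
        rw [Finset.sum_const, Finset.card_range, nsmul_eq_mul, ENNReal.ofReal_mul (by positivity),
          ENNReal.ofReal_natCast]
      · rw [eLpNorm_const_smul, ENNReal.ofReal_mul hκ0, Real.enorm_eq_ofReal hκ0]
        gcongr
    have hle : eLpNorm (F c) p μ ≤ ENNReal.ofReal (C * (N * A + κ * (h * B))) := by
      refine (eLpNorm_mono_real hpt).trans ?_
      rw [ENNReal.ofReal_mul hC0]
      have : (fun x => C * ((∑ l ∈ Finset.range N, T l) + κ • J) x) =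
        C • ((∑ l ∈ Finset.range N, T l) + κ • J) := rfl
      rw [this, eLpNorm_const_smul, Real.enorm_eq_ofReal hC0]
      gcongr
    refine hle.trans (ENNReal.ofReal_le_ofReal ?_)
    have hN1 : (1 : ℝ) ≤ N := by simp [hN]
    have hN2 : (N : ℝ) ≤ 2 ^ N := by exact_mod_cast Nat.lt_two_pow_self.le
    -- The number of nodes and the factor `N` in the remainder are polynomial losses; `4 ^ N`
    -- absorbs them, so `4e` becomes `16e`.
    have hN4 : (N : ℝ) * N ≤ 4 ^ N := by
      calc (N : ℝ) * N ≤ 2 ^ N * 2 ^ N := by gcongr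
        _ = 4 ^ N := by rw [← mul_pow]; norm_num
    have hN5 : (N : ℝ) ≤ 4 ^ N := by nlinarith
    have hfac : (c.factorial : ℝ) * (N - c).factorial ≤ N.factorial := by
      have := Nat.factorial_mul_factorial_dvd_factorial hc.le
      exact_mod_cast Nat.le_of_dvd (Nat.factorial_pos _) this
    have hpow : h ^ N = h ^ c * h ^ (N - c) := by rw [← pow_add]; congr 1; omega
    have e1 : c.factorial / h ^ c * (κ * h) ≤ N * N * (h ^ (N - c) / (N - c).factorial) := by
      have e2 : c.factorial / h ^ c * (κ * h) =
          N * N * (h ^ (N - c) * (c.factorial / N.factorial)) := by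
        have e3 : h ^ (N - 1) * h = h ^ c * h ^ (N - c) := by rw [← hpow, ← pow_succ]; rfl
        have e4 : (N.factorial : ℝ) = N * (N - 1).factorial := by
          rw [← Nat.mul_factorial_pred (by omega)]; push_cast; rfl
        have : κ * h = N * (h ^ (N - 1) * h / (N - 1).factorial) := by rw [hκ]; ring
        rw [this, e3, e4]
        have : (N : ℝ) ≠ 0 := by positivity
        field_simp
      rw [e2]
      have e5 : (c.factorial : ℝ) / N.factorial ≤ 1 / (N - c).factorial := by
        rw [div_le_div_iff₀ (by positivity) (by positivity)]; linarith
      calc _ ≤ (N : ℝ) * N * (h ^ (N - c) * (1 / (N - c).factorial)) := by gcongr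
        _ = _ := by ring
    calc C * (N * A + κ * (h * B)) = (4 * Real.exp 1) ^ N *
          (N * (c.factorial / h ^ c * A) + (c.factorial / h ^ c * (κ * h)) * B) := by
          rw [hC]; ring
      _ ≤ (4 * Real.exp 1) ^ N * (4 ^ N * (c.factorial / h ^ c * A) +
          (4 ^ N * (h ^ (N - c) / (N - c).factorial)) * B) := by
          refine mul_le_mul_of_nonneg_left (add_le_add ?_ ?_) (by positivity)
          · gcongr
          · refine mul_le_mul_of_nonneg_right (e1.trans ?_) hB
            gcongr
      _ = _ := by
          rw [show (16 : ℝ) * Real.exp 1 = 4 * (4 * Real.exp 1) by ring, mul_pow 4 (4 * Real.exp 1)]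
          ring

end LpBounds

/-! ### Partial derivatives and interpolation in several variables. -/

section MultiIndex

variable {n : ℕ} {𝕜 : Type*} [RCLike 𝕜] {f : EuclideanSpace ℝ (Fin n) → 𝕜}

theorem pderiv_eq_fderiv (hf : ContDiff ℝ (⊤ : ℕ∞) f) (i : Fin n) :
    pderiv i f = fun x => fderiv ℝ f x (EuclideanSpace.single i 1) := by
  ext x
  exact ((hf.differentiable (by simp)) x).lineDeriv_eq_fderiv

theorem contDiff_pderiv (hf : ContDiff ℝ (⊤ : ℕ∞) f) (i : Fin n) :
    ContDiff ℝ (⊤ : ℕ∞) (pderiv i f) := by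
  rw [pderiv_eq_fderiv hf]
  exact (hf.fderiv_right (m := ((⊤ : ℕ∞) : WithTop ℕ∞)) (by simp)).clm_apply contDiff_const

theorem pderiv_comm (hf : ContDiff ℝ (⊤ : ℕ∞) f) (i j : Fin n) :
    pderiv i (pderiv j f) = pderiv j (pderiv i f) := by
  have h1 : ∀ i j : Fin n, pderiv i (pderiv j f) = fun x =>
      fderiv ℝ (fderiv ℝ f) x (EuclideanSpace.single i 1) (EuclideanSpace.single j 1) := by
    intro i j
    rw [pderiv_eq_fderiv (contDiff_pderiv hf j), pderiv_eq_fderiv hf]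
    ext x
    have hd : DifferentiableAt ℝ (fderiv ℝ f) x :=
      ((hf.fderiv_right (m := ((⊤ : ℕ∞) : WithTop ℕ∞)) (by simp)).differentiable (by simp)) x
    rw [fderiv_clm_apply hd (differentiableAt_const _)]
    simp
  rw [h1, h1]
  ext x
  have hs : IsSymmSndFDerivAt ℝ f x := by
    refine hf.contDiffAt.isSymmSndFDerivAt ?_
    simp only [minSmoothness_of_isRCLikeNormedField]
    exact WithTop.coe_le_coe.2 le_top
  exact hs _ _

theorem contDiff_pderiv_iterate (hf : ContDiff ℝ (⊤ : ℕ∞) f) (i : Fin n) (c : ℕ) :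
    ContDiff ℝ (⊤ : ℕ∞) ((pderiv i)^[c] f) := by
  induction c with
  | zero => exact hf
  | succ c ih => rw [Function.iterate_succ_apply']; exact contDiff_pderiv ih i

theorem pderiv_iterate_comm (hf : ContDiff ℝ (⊤ : ℕ∞) f) (i j : Fin n) (c : ℕ) :
    pderiv j ((pderiv i)^[c] f) = (pderiv i)^[c] (pderiv j f) := by
  induction c with
  | zero => rfl
  | succ c ih =>
    rw [Function.iterate_succ_apply', Function.iterate_succ_apply',
      pderiv_comm (contDiff_pderiv_iterate hf i c), ih]

theorem contDiff_foldr_pderiv (hf : ContDiff ℝ (⊤ : ℕ∞) f) (l : List (Fin n)) (α : Fin n → ℕ) :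
    ContDiff ℝ (⊤ : ℕ∞) (l.foldr (fun i g => (pderiv i)^[α i] g) f) := by
  induction l with
  | nil => exact hf
  | cons i l ih => exact contDiff_pderiv_iterate ih i _

theorem contDiff_mderiv (hf : ContDiff ℝ (⊤ : ℕ∞) f) (α : Fin n → ℕ) :
    ContDiff ℝ (⊤ : ℕ∞) (mderiv α f) :=
  contDiff_foldr_pderiv hf _ α

theorem foldr_pderiv_add_single (hf : ContDiff ℝ (⊤ : ℕ∞) f) (l : List (Fin n)) (hl : l.Nodup)
    (α : Fin n → ℕ) (j : Fin n) :
    (l.foldr (fun i g => (pderiv i)^[(α + Pi.single j 1 : Fin n → ℕ) i] g) f) =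
      if j ∈ l then pderiv j (l.foldr (fun i g => (pderiv i)^[α i] g) f)
      else l.foldr (fun i g => (pderiv i)^[α i] g) f := by
  induction l with
  | nil => simp
  | cons i l ih =>
    rw [List.nodup_cons] at hl
    rw [List.foldr_cons, List.foldr_cons, ih hl.2]
    have hs := contDiff_foldr_pderiv hf l α
    by_cases hij : i = j
    · subst hij
      rw [if_neg hl.1, if_pos (by simp), Pi.add_apply, Pi.single_eq_same,
        Function.iterate_succ_apply']
    · have hji : j ≠ i := fun h => hij h.symm
      simp only [List.mem_cons, hji, false_or, Pi.add_apply, Pi.single_eq_of_ne hij, add_zero]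
      split_ifs
      · rw [pderiv_iterate_comm hs]
      · rfl

/-- Since partial derivatives commute, a new derivative may be put in its place in the fixed order.
Thus `q ↦ mderiv (α + Pi.single j q) f` is a chain of successive derivatives along the `j`-th axis.
-/
theorem mderiv_add_single (hf : ContDiff ℝ (⊤ : ℕ∞) f) (α : Fin n → ℕ) (j : Fin n) :
    mderiv (α + Pi.single j 1) f = pderiv j (mderiv α f) := by
  have := foldr_pderiv_add_single hf (List.finRange n) (List.nodup_finRange n) α j
  rwa [if_pos (List.mem_finRange j)] at this

theorem mderiv_zero (f : EuclideanSpace ℝ (Fin n) → 𝕜) : mderiv 0 f = f := by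
  unfold mderiv
  generalize List.finRange n = l
  induction l with
  | nil => rfl
  | cons i l ih => rw [List.foldr_cons, ih]; rfl

theorem mlen_add (α β : Fin n → ℕ) : mlen (α + β) = mlen α + mlen β := by
  simp [mlen, Finset.sum_add_distrib]

theorem mlen_zero : mlen (0 : Fin n → ℕ) = 0 := by simp [mlen]

theorem mlen_single (j : Fin n) (c : ℕ) : mlen (Pi.single j c) = c := by
  simp [mlen]

theorem eq_zero_of_mlen {α : Fin n → ℕ} (h : mlen α = 0) : α = 0 := by
  ext i
  exact (Finset.sum_eq_zero_iff.1 h) i (Finset.mem_univ i)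

theorem exists_add_eq_of_le_mlen (a : ℕ) : ∀ α : Fin n → ℕ, a ≤ mlen α →
    ∃ β γ, α = β + γ ∧ mlen β = a := by
  induction a with
  | zero => exact fun α _ => ⟨0, α, by simp, mlen_zero⟩
  | succ a ih =>
    intro α hα
    obtain ⟨β, γ, rfl, hβ⟩ := ih α (by omega)
    rw [mlen_add] at hα
    obtain ⟨j, hj⟩ : ∃ j, γ j ≠ 0 := by
      by_contra! hcon
      have : mlen γ = 0 := Finset.sum_eq_zero fun i _ => hcon i
      omega
    refine ⟨β + Pi.single j 1, γ - Pi.single j 1, ?_, by rw [mlen_add, hβ, mlen_single]⟩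
    rw [add_assoc]
    congr 1
    ext i
    by_cases hij : i = j
    · subst hij; simp; omega
    · simp [Pi.single_eq_of_ne hij]

theorem hasDerivAt_mderiv (hf : ContDiff ℝ (⊤ : ℕ∞) f) (α : Fin n → ℕ) (j : Fin n) (q : ℕ)
    (x : EuclideanSpace ℝ (Fin n)) (t : ℝ) :
    HasDerivAt (fun t : ℝ => mderiv (α + Pi.single j q) f (x + t • EuclideanSpace.single j (1 : ℝ)))
      (mderiv (α + Pi.single j (q + 1)) f (x + t • EuclideanSpace.single j (1 : ℝ))) t := by
  have h1 : α + Pi.single j (q + 1) = α + Pi.single j q + Pi.single j 1 := by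
    rw [add_assoc, ← Pi.single_add]
  rw [h1, mderiv_add_single hf, pderiv_eq_fderiv (contDiff_mderiv hf _)]
  have hd := ((contDiff_mderiv hf (α + Pi.single j q)).differentiable (by simp))
    (x + t • EuclideanSpace.single j (1 : ℝ))
  have hline : HasDerivAt (fun t : ℝ => x + t • EuclideanSpace.single j (1 : ℝ))
      (EuclideanSpace.single j (1 : ℝ)) t := by
    simpa using ((hasDerivAt_id t).smul_const (EuclideanSpace.single j (1 : ℝ))).const_add x
  exact hd.hasFDerivAt.comp_hasDerivAt t hline

/-- Translations by at most `h` in the coordinate directions map `S q` to `S (q + 1)`. -/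
def ShiftsInto (S : ℕ → Set (EuclideanSpace ℝ (Fin n))) (h : ℝ) : Prop :=
  ∀ (q : ℕ) (j : Fin n), ∀ x ∈ S q, ∀ t ∈ Icc 0 h, x + t • EuclideanSpace.single j (1 : ℝ) ∈ S (q + 1)

/-- The form `b!/h^b * A + h^(k-b)/(k-b)! * B` reproduces itself: taking it as the lower bound for
`c` further derivatives in a new direction gives the same form at `b + c`, at the price of `2 * C ^
k`. The reason is `b! c! ≤ (b + c)!`, used twice. -/
theorem combine_bounds {C h A B Q : ℝ} (hC : 1 ≤ C) (hh : 0 < h) (hA : 0 ≤ A) (hB : 0 ≤ B)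
    (hQ : 1 ≤ Q) {b c k : ℕ} (hbc : b + c ≤ k) :
    C ^ (k - b) * (c.factorial / h ^ c * (Q * (b.factorial / h ^ b * A +
      h ^ (k - b) / (k - b).factorial * B)) + h ^ (k - b - c) / (k - b - c).factorial * B) ≤
    (2 * C ^ k * Q) * ((b + c).factorial / h ^ (b + c) * A +
      h ^ (k - (b + c)) / (k - (b + c)).factorial * B) := by
  have hCk : C ^ (k - b) ≤ C ^ k := pow_le_pow_right₀ hC (Nat.sub_le k b)
  have hfac1 : (c.factorial : ℝ) * b.factorial ≤ (b + c).factorial := by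
    rw [mul_comm]
    exact_mod_cast Nat.le_of_dvd (Nat.factorial_pos _) (Nat.factorial_mul_factorial_dvd_factorial_add b c)
  have hfac2 : (c.factorial : ℝ) * (k - b - c).factorial ≤ (k - b).factorial := by
    exact_mod_cast Nat.le_of_dvd (Nat.factorial_pos _)
      (Nat.factorial_mul_factorial_dvd_factorial (by omega : c ≤ k - b))
  rw [Nat.sub_add_eq]
  set X := h ^ (k - b - c) / (k - b - c).factorial * B with hX
  have hX0 : 0 ≤ X := by positivity
  have e1 : c.factorial / h ^ c * (b.factorial / h ^ b * A) ≤
      (b + c).factorial / h ^ (b + c) * A := by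
    have : c.factorial / h ^ c * (b.factorial / h ^ b * A) =
      (c.factorial * b.factorial) / h ^ (b + c) * A := by rw [pow_add]; field_simp
    rw [this]
    gcongr
  have e2 : c.factorial / h ^ c * (h ^ (k - b) / (k - b).factorial * B) ≤ X := by
    have hp : h ^ (k - b) = h ^ c * h ^ (k - b - c) := by rw [← pow_add]; congr 1; omega
    have : c.factorial / h ^ c * (h ^ (k - b) / (k - b).factorial * B) =
        h ^ (k - b - c) * (c.factorial / (k - b).factorial) * B := by rw [hp]; field_simp
    rw [this, hX]
    have h3 : (c.factorial : ℝ) / (k - b).factorial ≤ 1 / (k - b - c).factorial := by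
      rw [div_le_div_iff₀ (by positivity) (by positivity)]; linarith
    calc _ ≤ h ^ (k - b - c) * (1 / (k - b - c).factorial) * B := by gcongr
      _ = _ := by ring
  set Y := (b + c).factorial / h ^ (b + c) * A with hY
  have hY0 : 0 ≤ Y := by positivity
  have hQX : X ≤ Q * X := le_mul_of_one_le_left hX0 hQ
  calc _ = C ^ (k - b) * (Q * (c.factorial / h ^ c * (b.factorial / h ^ b * A) +
        c.factorial / h ^ c * (h ^ (k - b) / (k - b).factorial * B)) + X) := by ring
    _ ≤ C ^ (k - b) * (Q * (Y + X) + Q * X) := by gcongr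
    _ ≤ C ^ k * (Q * (Y + X) + Q * X) := by gcongr
    _ ≤ C ^ k * (Q * (Y + X) + Q * X) + C ^ k * (Q * Y) := by
        have : 0 ≤ C ^ k * (Q * Y) := by positivity
        linarith
    _ = _ := by ring

theorem derivNorm_le_of_shift {p : ℝ≥0∞} (hp : 1 ≤ p) {S : ℕ → Set (EuclideanSpace ℝ (Fin n))}
    (hS : ∀ q, IsOpen (S q)) {h : ℝ} (hh : 0 < h) (hshift : ShiftsInto S h)
    (hf : ContDiff ℝ (⊤ : ℕ∞) f) {a k : ℕ} {A B : ℝ} (hA : 0 ≤ A) (hB : 0 ≤ B)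
    (hfA : ∀ q ≤ n, ∀ β : Fin n → ℕ, mlen β = a → derivNorm p (S q) β f ≤ ENNReal.ofReal A)
    (hfB : ∀ q ≤ n, ∀ β : Fin n → ℕ, mlen β = a + k → derivNorm p (S q) β f ≤ ENNReal.ofReal B)
    {i : ℕ} (hi : i ≤ k) {α : Fin n → ℕ} (hα : mlen α = a + i) :
    derivNorm p (S 0) α f ≤ ENNReal.ofReal ((2 * (16 * Real.exp 1) ^ k) ^ n *
      (i.factorial / h ^ i * A + h ^ (k - i) / (k - i).factorial * B)) := by
  have hC : 1 ≤ 16 * Real.exp 1 := by have := Real.one_le_exp (zero_le_one (α := ℝ)); linarith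
  set C := 16 * Real.exp 1 with hCdef
  have hCk : 1 ≤ C ^ k := one_le_pow₀ hC
  -- The excess `γ` over order `a` is built one coordinate at a time. Each coordinate uses one
  -- shift, from `S q` to `S (q + 1)`, so `S 0, …, S n` suffice.
  have main : ∀ s : Finset (Fin n), ∀ γ : Fin n → ℕ, (∀ i ∉ s, γ i = 0) → mlen γ ≤ k →
      ∀ α', mlen α' = a → ∀ q, q + s.card ≤ n → derivNorm p (S q) (α' + γ) f ≤
        ENNReal.ofReal ((2 * C ^ k) ^ s.card * ((mlen γ).factorial / h ^ mlen γ * A +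
          h ^ (k - mlen γ) / (k - mlen γ).factorial * B)) := by
    intro s
    induction s using Finset.induction_on with
    | empty =>
      intro γ hγ hγk α' hα' q hq
      obtain rfl : γ = 0 := by ext i; exact hγ i (by simp)
      rw [add_zero]
      refine (hfA q (by simpa using hq) α' hα').trans (ENNReal.ofReal_le_ofReal ?_)
      rw [mlen_zero]
      simp only [Finset.card_empty, pow_zero, Nat.factorial_zero, Nat.cast_one, div_one, one_mul]
      have : 0 ≤ h ^ (k - 0) / (k - 0).factorial * B := by positivity
      linarith
    | insert j s hj ih =>
      intro γ hγ hγk α' hα' q hq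
      rw [Finset.card_insert_of_notMem hj] at hq ⊢
      set γ' := Function.update γ j 0 with hγ'
      have hdec : γ = γ' + Pi.single j (γ j) := by
        ext i
        by_cases hij : i = j
        · subst hij; simp [hγ']
        · simp [hγ', hij]
      have hlen : mlen γ = mlen γ' + γ j := by
        conv_lhs => rw [hdec]
        rw [mlen_add, mlen_single]
      have hγ's : ∀ i ∉ s, γ' i = 0 := by
        intro i hi
        by_cases hij : i = j
        · subst hij; simp [hγ']
        · rw [hγ', Function.update_of_ne hij]
          exact hγ i (by simp [hij, hi])
      have h0 := ih γ' hγ's (by omega) α' hα' (q + 1) (by omega)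
      have hQ : 1 ≤ (2 * C ^ k) ^ s.card := one_le_pow₀ (by linarith)
      -- With `N = k - mlen γ'` the top derivative in direction `j` has total order `a + k`, where
      -- `hfB` applies.
      have key := eLpNorm_deriv_le hp (hS q) (hS (q + 1)) hh (hshift q j)
        (fun t => mderiv (α' + γ' + Pi.single j t) f)
        (fun t => (contDiff_mderiv hf _).continuous)
        (fun t x u => hasDerivAt_mderiv hf _ j t x u)
        (c := γ j) (N := k - mlen γ') (by omega)
        (A := (2 * C ^ k) ^ s.card * ((mlen γ').factorial / h ^ mlen γ' * A +
          h ^ (k - mlen γ') / (k - mlen γ').factorial * B)) (B := B) (by positivity) hB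
        (by simpa [derivNorm] using h0)
        (hfB (q + 1) (by omega) _ (by rw [mlen_add, mlen_add, mlen_single]; omega))
      unfold derivNorm
      rw [hlen]
      conv_lhs => rw [hdec, ← add_assoc]
      refine key.trans (ENNReal.ofReal_le_ofReal ?_)
      refine (combine_bounds (b := mlen γ') (c := γ j) (k := k) hC hh hA hB hQ
        (by omega)).trans (le_of_eq ?_)
      rw [pow_succ]; ring
  obtain ⟨β, γ, rfl, hβ⟩ := exists_add_eq_of_le_mlen a α (by omega)
  have hγ : mlen γ = i := by rw [mlen_add] at hα; omega
  have := main Finset.univ γ (by simp) (by omega) β hβ 0 (by simp)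
  rwa [hγ, Finset.card_univ, Fintype.card_fin] at this

/-- A constant for the interpolation of derivatives in dimension `n`. -/
def interpConst (n : ℕ) : ℝ := (2 * (16 * Real.exp 1)) ^ n * (2 * Real.exp 1)

theorem one_le_interpConst (n : ℕ) : 1 ≤ interpConst n := by
  have := Real.one_le_exp (zero_le_one (α := ℝ))
  unfold interpConst
  have h1 : 1 ≤ (2 * (16 * Real.exp 1)) ^ n := one_le_pow₀ (by linarith)
  nlinarith

/-- Interpolation of derivatives with a constant that is exponential in the order. -/
theorem derivNorm_interpolate {p : ℝ≥0∞} (hp : 1 ≤ p) {S : ℕ → Set (EuclideanSpace ℝ (Fin n))}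
    (hS : ∀ q, IsOpen (S q)) (hf : ContDiff ℝ (⊤ : ℕ∞) f) {a k : ℕ} (hk : 1 ≤ k) {A R : ℝ}
    (hA : 0 ≤ A) (hR : 0 < R) (hshift : ShiftsInto S (k / R))
    (hfA : ∀ q ≤ n, ∀ β : Fin n → ℕ, mlen β = a → derivNorm p (S q) β f ≤ ENNReal.ofReal A)
    (hfB : ∀ q ≤ n, ∀ β : Fin n → ℕ, mlen β = a + k →
      derivNorm p (S q) β f ≤ ENNReal.ofReal (A * R ^ k))
    {i : ℕ} (hi : i ≤ k) {α : Fin n → ℕ} (hα : mlen α = a + i) :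
    derivNorm p (S 0) α f ≤ ENNReal.ofReal (interpConst n ^ k * (A * R ^ i)) := by
  have hk0 : (0 : ℝ) < k := by exact_mod_cast hk
  have he : 1 ≤ Real.exp 1 := Real.one_le_exp zero_le_one
  refine (derivNorm_le_of_shift hp hS (div_pos hk0 hR) hshift hf hA (by positivity) hfA hfB hi
    hα).trans (ENNReal.ofReal_le_ofReal ?_)
  -- The step `h = k / R` balances both terms: `i! ≤ k ^ i` handles the first and `k ^ (k-i) /
  -- (k-i)! ≤ e ^ k` the second, each leaving `A * R ^ i`.
  have e1 : i.factorial / (k / R) ^ i * A ≤ A * R ^ i := by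
    have h1 : (i.factorial : ℝ) ≤ (k : ℝ) ^ i := by
      calc (i.factorial : ℝ) ≤ (i : ℝ) ^ i := by exact_mod_cast Nat.factorial_le_pow i
        _ ≤ (k : ℝ) ^ i := by gcongr
    have h2 : i.factorial / (k / R) ^ i * A = (i.factorial / (k : ℝ) ^ i) * (A * R ^ i) := by
      rw [div_pow]; field_simp
    rw [h2]
    refine mul_le_of_le_one_left (by positivity) ?_
    rwa [div_le_one (by positivity)]
  have e2 : (k / R) ^ (k - i) / (k - i).factorial * (A * R ^ k) ≤ Real.exp 1 ^ k * (A * R ^ i) := by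
    have h1 := Real.pow_div_factorial_le_exp (k : ℝ) hk0.le (k - i)
    rw [← mul_one (k : ℝ), Real.exp_nat_mul, mul_one] at h1
    have h2 : R ^ k = R ^ i * R ^ (k - i) := by rw [← pow_add]; congr 1; omega
    have h3 : (k / R) ^ (k - i) / (k - i).factorial * (A * R ^ k) =
        ((k : ℝ) ^ (k - i) / (k - i).factorial) * (A * R ^ i) := by
      rw [h2, div_pow]; field_simp
    rw [h3]
    gcongr
  have h2k : (1 : ℝ) + Real.exp 1 ^ k ≤ (2 * Real.exp 1) ^ k := by
    rw [mul_pow]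
    have h1 : 1 ≤ Real.exp 1 ^ k := one_le_pow₀ he
    have h2 : (2 : ℝ) ≤ 2 ^ k := le_self_pow₀ (by norm_num) (by omega)
    nlinarith
  have h2n : (2 * (16 * Real.exp 1) ^ k) ^ n ≤ ((2 * (16 * Real.exp 1)) ^ n) ^ k := by
    rw [← pow_mul, mul_comm n k, pow_mul, mul_pow 2 _ k]
    gcongr
    exact le_self_pow₀ (by norm_num) (by omega)
  have hAR : 0 ≤ A * R ^ i := by positivity
  calc _ ≤ ((2 * (16 * Real.exp 1)) ^ n) ^ k * (A * R ^ i + Real.exp 1 ^ k * (A * R ^ i)) := by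
        gcongr
    _ = ((2 * (16 * Real.exp 1)) ^ n) ^ k * ((1 + Real.exp 1 ^ k) * (A * R ^ i)) := by ring
    _ ≤ ((2 * (16 * Real.exp 1)) ^ n) ^ k * ((2 * Real.exp 1) ^ k * (A * R ^ i)) := by gcongr
    _ = _ := by rw [interpConst, mul_pow _ (2 * Real.exp 1)]; ring

end MultiIndex

/-! ### From lacunary bounds to bounds of all orders. -/

section Core

variable {n : ℕ} {𝕜 : Type*} [RCLike 𝕜] {ω : ℝ → ℝ}

theorem exists_root_pow {y : ℝ} (hy : 0 < y) {k : ℕ} (hk : 1 ≤ k) : ∃ R : ℝ, 0 < R ∧ R ^ k = y :=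
  ⟨y ^ (1 / (k : ℝ)), Real.rpow_pos_of_pos hy _, by
    rw [one_div, Real.rpow_inv_natCast_pow hy.le (by omega)]⟩

theorem pow_mul_bmtWeight_le (hω : IsWeightFunction ω) (K : ℝ) (A : ℕ) (hA : 1 ≤ A) :
    ∃ L : ℝ, 0 < L ∧ ∀ ρ, 0 < ρ → ∃ D : ℝ, 0 < D ∧ ∀ m : ℕ,
      (|K| ^ A) ^ m * bmtWeight ω (A * ρ) m ≤ D * bmtWeight ω (L * ρ) m := by
  obtain ⟨L, hL, h⟩ := bmtWeight_pow hω (|K| ^ A)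
  have hA0 : (0 : ℝ) < A := by exact_mod_cast hA
  refine ⟨L * A, by positivity, fun ρ hρ => ?_⟩
  obtain ⟨D, hD, h'⟩ := h (A * ρ) (by positivity)
  refine ⟨D, hD, fun m => ?_⟩
  have := h' m
  rwa [abs_of_nonneg (by positivity), ← mul_assoc] at this

theorem IsSpecialBaseSequence.exists_block_nat {k : ℕ → ℕ} (hk : IsSpecialBaseSequence k) :
    ∃ A : ℕ, 1 ≤ A ∧ ∀ m : ℕ, 0 < m → ∃ a i d, (∃ j, k j = a) ∧ (∃ j, k j = a + d) ∧ m = a + i ∧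
      i ≤ d ∧ 1 ≤ d ∧ a + d ≤ A * m := by
  obtain ⟨A, hA, h⟩ := hk.exists_block
  refine ⟨⌈A⌉₊, Nat.one_le_ceil_iff.2 (by linarith), fun m hm => ?_⟩
  obtain ⟨j, h1, h2, h3⟩ := h m hm
  refine ⟨k j, m - k j, k (j + 1) - k j, ⟨j, rfl⟩, ⟨j + 1, by omega⟩, by omega, by omega, by omega,
    ?_⟩
  have : (k (j + 1) : ℝ) ≤ ⌈A⌉₊ * m := h3.trans (by gcongr; exact Nat.le_ceil A)
  have : k (j + 1) ≤ ⌈A⌉₊ * m := by exact_mod_cast this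
  omega

/-- An abstract interpolation principle: bounds `C * bmtWeight ω ρ (k j)` at the orders `k j`
propagate to all orders, if they propagate from `a` and `a + d` to `a + i` in the form of an
interpolation inequality with the constant `K ^ d`. -/
theorem exists_bound_of_lacunary (hω : IsWeightFunction ω) {k : ℕ → ℕ}
    (hk : IsSpecialBaseSequence k) {K : ℝ} (hK : 1 ≤ K) :
    ∃ L : ℝ, 0 < L ∧ ∀ ρ, 0 < ρ → ∀ D, 1 ≤ D → ∀ C, 0 < C → ∃ C', 0 < C' ∧
      ∀ Q : ℕ → ℝ → Prop, (∀ m s t, s ≤ t → Q m s → Q m t) → Q 0 (C * bmtWeight ω ρ 0) →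
        (∀ a i d : ℕ, i ≤ d → 1 ≤ d → ∀ s R : ℝ, 0 < s → 0 < R → D * bmtWeight ω ρ d ≤ R ^ d →
          (∃ j, k j = a) → (∃ j, k j = a + d) → C * bmtWeight ω ρ a ≤ s →
          C * bmtWeight ω ρ (a + d) ≤ s * R ^ d → Q (a + i) (K ^ d * (s * R ^ i))) →
        ∀ m, Q m (C' * bmtWeight ω (L * ρ) m) := by
  obtain ⟨A, hA, hblock⟩ := hk.exists_block_nat
  obtain ⟨L, hL, hpow⟩ := pow_mul_bmtWeight_le hω K A hA
  refine ⟨L, hL, fun ρ hρ D hD C hC => ?_⟩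
  obtain ⟨D', hD', hpow⟩ := hpow ρ hρ
  have hA1 : (1 : ℝ) ≤ A := by exact_mod_cast hA
  -- The summand `c` of the final constant serves only the order `m = 0`, which lies outside the
  -- block argument.
  set c := C / bmtWeight ω (L * ρ) 0 with hc
  have hc0 : 0 < c := div_pos hC (bmtWeight_pos _ _ _)
  set C₁ := C * (D * Real.exp (ω 1 / (A * ρ))) * D' with hC₁
  have hC₁0 : 0 < C₁ := by positivity
  refine ⟨c + C₁, by positivity, fun Q hQ h0 hint m => ?_⟩
  rcases Nat.eq_zero_or_pos m with rfl | hm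
  · refine hQ _ _ _ ?_ h0
    have h1 : c * bmtWeight ω (L * ρ) 0 = C := div_mul_cancel₀ _ (bmtWeight_pos _ _ _).ne'
    have h2 : C * bmtWeight ω ρ 0 ≤ C * 1 := by gcongr; exact bmtWeight_zero_le_one hω hρ
    have h3 : 0 < C₁ * bmtWeight ω (L * ρ) 0 := mul_pos hC₁0 (bmtWeight_pos _ _ _)
    rw [add_mul]
    linarith
  · obtain ⟨a, i, d, ha, hb, rfl, hid, hd, hAm⟩ := hblock m hm
    have hWa := bmtWeight_pos ω ρ a
    have hWb := bmtWeight_pos ω ρ (a + d)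
    have hWd := bmtWeight_pos ω ρ d
    -- `R ^ d` is the quotient of the endpoint weights, inflated by `D`. Supermultiplicativity then
    -- yields `D * W_ρ(d) ≤ R ^ d`, and `D ≥ 1` keeps the bound at `a + d` valid.
    obtain ⟨R, hR, hRd⟩ := exists_root_pow
      (y := D * bmtWeight ω ρ (a + d) / bmtWeight ω ρ a) (by positivity) hd
    have hsR : C * bmtWeight ω ρ a * R ^ d = D * (C * bmtWeight ω ρ (a + d)) := by
      rw [hRd]; field_simp
    have key := hint a i d hid hd (C * bmtWeight ω ρ a) R (by positivity) hR (by
      rw [hRd, le_div_iff₀ hWa, mul_assoc]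
      gcongr
      rw [mul_comm]
      exact bmtWeight_mul_le hω hρ a d) ha hb le_rfl
      (by rw [hsR]; exact le_mul_of_one_le_left (by positivity) hD)
    refine hQ _ _ _ ?_ key
    have h1 := bmtWeight_interpolate hω hρ hA1 hD hR (by omega) hid hm (by exact_mod_cast hAm) hRd
    have h2 : K ^ d ≤ (|K| ^ A) ^ (a + i) := by
      -- As `d ≤ a + d ≤ A * (a + i)`, the constant `K ^ d` is exponential in the order `a + i`
      -- itself.
      rw [← pow_mul]
      calc K ^ d ≤ K ^ (A * (a + i)) := pow_le_pow_right₀ hK (by omega)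
        _ = |K| ^ (A * (a + i)) := by rw [abs_of_nonneg (by linarith)]
    have hW' := bmtWeight_pos ω (A * ρ) (a + i)
    have hWL := bmtWeight_pos ω (L * ρ) (a + i)
    calc K ^ d * (C * bmtWeight ω ρ a * R ^ i) = K ^ d * (C * (bmtWeight ω ρ a * R ^ i)) := by ring
      _ ≤ (|K| ^ A) ^ (a + i) *
          (C * (D * Real.exp (ω 1 / (A * ρ)) * bmtWeight ω (A * ρ) (a + i))) := by gcongr
      _ = C * (D * Real.exp (ω 1 / (A * ρ))) *
          ((|K| ^ A) ^ (a + i) * bmtWeight ω (A * ρ) (a + i)) := by ring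
      _ ≤ C * (D * Real.exp (ω 1 / (A * ρ))) * (D' * bmtWeight ω (L * ρ) (a + i)) := by
          exact mul_le_mul_of_nonneg_left (hpow _) (by positivity)
      _ = C₁ * bmtWeight ω (L * ρ) (a + i) := by rw [hC₁]; ring
      _ ≤ _ := by
        gcongr
        linarith

/-- Lacunary bounds of the derivatives imply bounds of all derivatives. The open sets `S q` have to
be stable under small shifts only. -/
theorem exists_derivNorm_bound_of_lacunary (n : ℕ) (hω : IsWeightFunction ω) {k : ℕ → ℕ}
    (hk : IsSpecialBaseSequence k) :
    ∃ L : ℝ, 0 < L ∧ ∀ ρ, 0 < ρ → ∀ D, 1 ≤ D → ∀ C, 0 < C → ∃ C', 0 < C' ∧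
      ∀ (p : ℝ≥0∞), 1 ≤ p → ∀ S : ℕ → Set (EuclideanSpace ℝ (Fin n)), (∀ q, IsOpen (S q)) →
        (∀ d : ℕ, 1 ≤ d → ∀ R : ℝ, 0 < R → D * bmtWeight ω ρ d ≤ R ^ d → ShiftsInto S (d / R)) →
        ∀ f : EuclideanSpace ℝ (Fin n) → 𝕜, ContDiff ℝ (⊤ : ℕ∞) f →
        (∀ q ≤ n, ∀ (j : ℕ) (β : Fin n → ℕ), mlen β = k j →
          derivNorm p (S q) β f ≤ ENNReal.ofReal (C * bmtWeight ω ρ (k j))) →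
        ∀ α : Fin n → ℕ, derivNorm p (S 0) α f ≤
          ENNReal.ofReal (C' * bmtWeight ω (L * ρ) (mlen α)) := by
  obtain ⟨L, hL, h⟩ := exists_bound_of_lacunary hω hk (one_le_interpConst n)
  refine ⟨L, hL, fun ρ hρ D hD C hC => ?_⟩
  obtain ⟨C', hC', h⟩ := h ρ hρ D hD C hC
  refine ⟨C', hC', fun p hp S hS hshift f hf hbase α => ?_⟩
  refine h (fun m s => ∀ β : Fin n → ℕ, mlen β = m → derivNorm p (S 0) β f ≤ ENNReal.ofReal s)
    (fun m s t hst hs β hβ => (hs β hβ).trans (ENNReal.ofReal_le_ofReal hst)) ?_ ?_ (mlen α) α rfl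
  · intro β hβ
    have := hbase 0 (Nat.zero_le n) 0 β (by rw [hβ, hk.1.1])
    rwa [hk.1.1] at this
  · rintro a i d hid hd s R hs hR hDR ⟨j, rfl⟩ ⟨j', hj'⟩ has hbs β hβ
    refine derivNorm_interpolate hp hS hf hd hs.le hR (hshift d hd R hR hDR) (a := k j)
      (fun q hq γ hγ => (hbase q hq j γ hγ).trans (ENNReal.ofReal_le_ofReal has))
      (fun q hq γ hγ => ?_) hid hβ
    refine (hbase q hq j' γ (by rw [hγ, hj'])).trans (ENNReal.ofReal_le_ofReal ?_)
    rwa [hj']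

/-- The moments of a nonnegative quantity are controlled by lacunary moments. -/
theorem exists_moment_bound_of_lacunary (hω : IsWeightFunction ω) {k : ℕ → ℕ}
    (hk : IsSpecialBaseSequence k) :
    ∃ L : ℝ, 0 < L ∧ ∀ ρ, 0 < ρ → ∀ C, 0 < C → ∃ C', 0 < C' ∧ ∀ X v : ℝ, 0 ≤ X → 0 ≤ v →
      (∀ j, X ^ k j * v ≤ C * bmtWeight ω ρ (k j)) →
      ∀ m, X ^ m * v ≤ C' * bmtWeight ω (L * ρ) m := by
  obtain ⟨L, hL, h⟩ := exists_bound_of_lacunary hω hk le_rfl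
  refine ⟨L, hL, fun ρ hρ C hC => ?_⟩
  obtain ⟨C', hC', h⟩ := h ρ hρ 1 le_rfl C hC
  refine ⟨C', hC', fun X v hX hv hbase => ?_⟩
  refine h (fun m s => X ^ m * v ≤ s) (fun m s t hst hs => hs.trans hst) ?_ ?_
  · have := hbase 0
    rwa [hk.1.1] at this
  · rintro a i d hid hd s R hs hR - ⟨j, rfl⟩ ⟨j', hj'⟩ has hbs
    have ha := (hbase j).trans has
    have hb := hbase j'
    rw [hj'] at hb
    replace hb := hb.trans hbs
    rw [one_pow, one_mul]
    -- For moments the interpolation is elementary, with constant `1`: if `X ≤ R`, multiply the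
    -- lower moment by `X ^ i`; otherwise divide the upper one by `R ^ (d - i)`.
    rcases le_total X R with hXR | hXR
    · calc X ^ (k j + i) * v = (X ^ k j * v) * X ^ i := by rw [pow_add]; ring
        _ ≤ s * R ^ i := by gcongr
    · have hRp : 0 < R ^ (d - i) := by positivity
      refine le_of_mul_le_mul_right ?_ hRp
      calc X ^ (k j + i) * v * R ^ (d - i) ≤ X ^ (k j + i) * v * X ^ (d - i) := by gcongr
        _ = X ^ (k j + d) * v := by
          rw [mul_right_comm, ← pow_add]; congr 2; omega
        _ ≤ s * R ^ d := hb
        _ = s * R ^ i * R ^ (d - i) := by rw [mul_assoc, ← pow_add]; congr 2; omega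

end Core

/-! ### The global classes. -/

section Global

variable {n : ℕ} {𝕜 : Type*} [RCLike 𝕜] {ω : ℝ → ℝ} {k : ℕ → ℕ}

theorem classBLac_eq (hω : IsWeightFunction ω) (hk : IsSpecialBaseSequence k) (τ : ClassType)
    {p : ℝ≥0∞} (hp : 1 ≤ p) : classBLac 𝕜 n τ ω p k = classB 𝕜 n τ ω p := by
  ext f
  constructor
  · rintro ⟨hf, h⟩
    obtain ⟨L, hL, hcore⟩ := exists_derivNorm_bound_of_lacunary (𝕜 := 𝕜) n hω hk
    refine ⟨hf, h.transfer' hL ?_⟩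
    rintro ρ hρ ⟨C, hC, hb⟩
    obtain ⟨C', hC', hcore⟩ := hcore ρ hρ 1 le_rfl C hC
    -- The whole space is stable under all shifts, so no condition on the step arises and `D = 1`
    -- serves.
    exact ⟨C', hC', hcore p hp (fun _ => univ) (fun _ => isOpen_univ)
      (fun _ _ _ _ _ _ _ _ _ _ _ => mem_univ _) f hf (fun _ _ => hb)⟩
  · rintro ⟨hf, h⟩
    refine ⟨hf, h.mono ?_⟩
    rintro ρ hρ ⟨C, hC, hb⟩
    exact ⟨C, hC, fun j α hα => hα ▸ hb α⟩

end Global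

/-! ### The local classes. -/

section Local

variable {n : ℕ} {𝕜 : Type*} [RCLike 𝕜] {ω : ℝ → ℝ} {k : ℕ → ℕ}
  {f g : EuclideanSpace ℝ (Fin n) → 𝕜} {O : Set (EuclideanSpace ℝ (Fin n))}

theorem pderiv_eqOn (hO : IsOpen O) (h : EqOn f g O) (i : Fin n) :
    EqOn (pderiv i f) (pderiv i g) O := fun _ hx =>
  Filter.EventuallyEq.lineDeriv_eq (eventually_of_mem (hO.mem_nhds hx) h)

theorem mderiv_eqOn (hO : IsOpen O) (h : EqOn f g O) (α : Fin n → ℕ) :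
    EqOn (mderiv α f) (mderiv α g) O := by
  unfold mderiv
  induction List.finRange n with
  | nil => exact h
  | cons i l ih =>
    rw [List.foldr_cons, List.foldr_cons]
    generalize α i = c
    induction c with
    | zero => exact ih
    | succ c ihc =>
      rw [Function.iterate_succ_apply', Function.iterate_succ_apply']
      exact pderiv_eqOn hO ihc i

theorem derivNorm_congr (hO : IsOpen O) (h : EqOn f g O) (p : ℝ≥0∞) (α : Fin n → ℕ) :
    derivNorm p O α f = derivNorm p O α g :=
  eLpNorm_congr_ae ((ae_restrict_mem hO.measurableSet).mono fun _ hx => mderiv_eqOn hO h α hx)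

theorem derivNorm_mono_set {O' : Set (EuclideanSpace ℝ (Fin n))} (h : O ⊆ O') (p : ℝ≥0∞)
    (α : Fin n → ℕ) (f : EuclideanSpace ℝ (Fin n) → 𝕜) :
    derivNorm p O α f ≤ derivNorm p O' α f :=
  eLpNorm_mono_measure _ (Measure.restrict_mono h le_rfl)

/-- The interpolation requires functions smooth on all of `ℝⁿ`; multiplying by a cutoff supplies one
that agrees with `f` where the estimates take place. -/
theorem exists_contDiff_eqOn {U Z T : Set (EuclideanSpace ℝ (Fin n))} (hU : IsOpen U)
    (hf : ContDiffOn ℝ (⊤ : ℕ∞) f U) (hZ : IsClosed Z) (hT : IsClosed T) (hZT : Z ⊆ interior T)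
    (hTU : T ⊆ U) : ∃ g : EuclideanSpace ℝ (Fin n) → 𝕜, ContDiff ℝ (⊤ : ℕ∞) g ∧ EqOn f g Z := by
  obtain ⟨χ, h1, h0, -⟩ := exists_contMDiffMap_one_nhds_of_subset_interior
    (modelWithCornersSelf ℝ (EuclideanSpace ℝ (Fin n))) (n := (⊤ : ℕ∞)) hZ hZT
  have hχ : ContDiff ℝ (⊤ : ℕ∞) χ := χ.contMDiff.contDiff
  refine ⟨fun x => χ x • f x, contDiff_iff_contDiffAt.2 fun x => ?_, fun x hx => ?_⟩
  · by_cases hx : x ∈ T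
    · exact hχ.contDiffAt.smul (hf.contDiffAt (hU.mem_nhds (hTU hx)))
    · refine (contDiffAt_const (c := (0 : 𝕜))).congr_of_eventuallyEq ?_
      filter_upwards [hT.isOpen_compl.mem_nhds hx] with y hy
      rw [h0 y hy, zero_smul]
  · have : χ x = 1 := h1.self_of_nhdsSet x hx
    simp [this]

theorem shiftsInto_thickening {δ h : ℝ} (h' : h ≤ δ) (Ω : Set (EuclideanSpace ℝ (Fin n))) :
    ShiftsInto (fun q : ℕ => Metric.thickening ((q + 1) * δ) Ω) h := by
  intro q j x hx t ht
  rw [Metric.mem_thickening_iff] at hx ⊢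
  obtain ⟨z, hz, hxz⟩ := hx
  refine ⟨z, hz, ?_⟩
  have h1 : dist (x + t • EuclideanSpace.single j (1 : ℝ)) x ≤ δ := by
    rw [dist_eq_norm, add_sub_cancel_left, norm_smul, PiLp.norm_single, norm_one, mul_one,
      Real.norm_of_nonneg ht.1]
    exact ht.2.trans h'
  have h2 := dist_triangle (x + t • EuclideanSpace.single j (1 : ℝ)) x z
  push_cast
  linarith

/-- Here the growth condition enters: `(d / δ) ^ d ≤ R ^ d` says that the interpolation step `d / R`
is at most `δ`. -/
theorem DominatesFactorial.div_le {D δ ρ R : ℝ} (hδ : 0 < δ) (hR : 0 < R)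
    (hD : ∀ k : ℕ, 1 ≤ k → ((k : ℝ) / δ) ^ k ≤ D * bmtWeight ω ρ k) {d : ℕ} (hd : 1 ≤ d)
    (h : D * bmtWeight ω ρ d ≤ R ^ d) : (d : ℝ) / R ≤ δ := by
  have h1 := (hD d hd).trans h
  rw [pow_le_pow_iff_left₀ (by positivity) hR.le (by omega), div_le_iff₀ hδ] at h1
  rw [div_le_iff₀ hR]
  linarith

theorem classELac_eq (hω : IsWeightFunction ω) (hk : IsSpecialBaseSequence k) {τ : ClassType}
    (hτ : τ.Growth ω) {p : ℝ≥0∞} (hp : 1 ≤ p) {U : Set (EuclideanSpace ℝ (Fin n))}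
    (hU : IsOpen U) : classELac 𝕜 τ ω p k U = classE 𝕜 τ ω p U := by
  ext f
  constructor
  · rintro ⟨hf, h⟩
    refine ⟨hf, fun Ω hΩ => ?_⟩
    obtain ⟨η, hη, hηU⟩ := hΩ.2.1.exists_cthickening_subset_open hU hΩ.2.2
    have hn : (0 : ℝ) < n + 1 := by positivity
    -- The `n + 1` nested thickenings, of radii `δ, …, (n + 1) δ`, must stay inside the `η /
    -- 2`-neighbourhood `Ω'`, where the lacunary hypothesis is applied; `δ ≤ 1` is needed for
    -- `ClassType.Growth.ample`.
    set δ : ℝ := min 1 (η / 2 / (n + 1)) with hδ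
    have hδ0 : 0 < δ := by positivity
    have hδη : (n + 1) * δ ≤ η / 2 := by
      have : δ ≤ η / 2 / (n + 1) := min_le_right _ _
      rw [le_div_iff₀ hn] at this
      linarith
    set Ω' := Metric.thickening (η / 2) Ω with hΩ'
    have hcl : closure Ω' ⊆ Metric.cthickening (η / 2) (closure Ω) := by
      rw [Metric.cthickening_closure]
      exact Metric.closure_thickening_subset_cthickening _ _
    have hΩ'U : RelCompactOpen Ω' U :=
      ⟨Metric.isOpen_thickening, hΩ.2.1.cthickening.of_isClosed_subset isClosed_closure hcl,
        hcl.trans ((Metric.cthickening_mono (by linarith) _).trans hηU)⟩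
    obtain ⟨g, hg, hfg⟩ := exists_contDiff_eqOn hU hf
      (Metric.isClosed_cthickening (δ := η / 2) (E := closure Ω))
      (Metric.isClosed_cthickening (δ := η) (E := closure Ω))
      ((Metric.cthickening_subset_thickening' hη (by linarith) _).trans
        (interior_maximal (Metric.thickening_subset_cthickening _ _) Metric.isOpen_thickening)) hηU
    have hSΩ' : ∀ q : ℕ, q ≤ n → Metric.thickening ((q + 1) * δ) Ω ⊆ Ω' := by
      intro q hq
      refine Metric.thickening_mono (le_trans ?_ hδη) _
      gcongr
    have hΩS : Ω ⊆ Metric.thickening (((0 : ℕ) + 1) * δ) Ω :=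
      Metric.self_subset_thickening (by simpa using hδ0) _
    have hfgS : ∀ O ⊆ Ω', EqOn f g O := fun O hO x hx =>
      hfg (hcl (subset_closure (hO hx)))
    obtain ⟨L, hL, hcore⟩ := exists_derivNorm_bound_of_lacunary (𝕜 := 𝕜) n hω hk
    refine (h Ω' hΩ'U).transfer hL (hτ.ample hω hδ0 (min_le_left _ _)) ?_ ?_
    · rintro ρ ρ' hρ hρρ' ⟨C, hC, hb⟩
      refine ⟨C * Real.exp (ω 1 / ρ'), by positivity, fun j α hα => (hb j α hα).trans
        (ENNReal.ofReal_le_ofReal ?_)⟩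
      rw [mul_assoc]
      gcongr
      exact bmtWeight_le_of_le hω hρ hρρ' _
    · rintro ρ hρ ⟨D, hD, hfac⟩ ⟨C, hC, hb⟩
      obtain ⟨C', hC', hcore⟩ := hcore ρ hρ D hD C hC
      refine ⟨C', hC', fun α => ?_⟩
      have := hcore p hp (fun q => Metric.thickening ((q + 1) * δ) Ω)
        (fun q => Metric.isOpen_thickening)
        (fun d hd R hR hDR => shiftsInto_thickening
          (DominatesFactorial.div_le hδ0 hR hfac hd hDR) Ω) g hg
        (fun q hq j β hβ => by
          rw [← derivNorm_congr Metric.isOpen_thickening (hfgS _ (hSΩ' q hq))]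
          exact (derivNorm_mono_set (hSΩ' q hq) p β f).trans (hb j β hβ)) α
      rw [← derivNorm_congr Metric.isOpen_thickening (hfgS _ (hSΩ' 0 (Nat.zero_le n)))] at this
      exact (derivNorm_mono_set hΩS p α f).trans this
  · rintro ⟨hf, h⟩
    refine ⟨hf, fun Ω hΩ => (h Ω hΩ).mono ?_⟩
    rintro ρ hρ ⟨C, hC, hb⟩
    exact ⟨C, hC, fun j α hα => hα ▸ hb α⟩

end Local

/-! ### The Gelfand–Shilov classes. -/

section GelfandShilov

variable {n : ℕ} {𝕜 : Type*} [RCLike 𝕜] {ω : ℝ → ℝ} {k l : ℕ → ℕ}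
  {f : EuclideanSpace ℝ (Fin n) → 𝕜}

theorem monom_zero (x : EuclideanSpace ℝ (Fin n)) : monom 0 x = 1 := by simp [monom]

theorem monom_single (j : Fin n) (c : ℕ) (x : EuclideanSpace ℝ (Fin n)) :
    monom (Pi.single j c) x = x j ^ c := by
  unfold monom
  rw [Finset.prod_eq_single j]
  · simp
  · intro i _ hij
    simp [Pi.single_eq_of_ne hij]
  · simp

theorem abs_monom_le {x : EuclideanSpace ℝ (Fin n)} {X : ℝ} (hX : ∀ i, |x i| ≤ X)
    (α : Fin n → ℕ) : |monom α x| ≤ X ^ mlen α := by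
  unfold monom mlen
  rw [Finset.abs_prod, ← Finset.prod_pow_eq_pow_sum]
  refine Finset.prod_le_prod (fun _ _ => abs_nonneg _) fun i _ => ?_
  rw [abs_pow]
  exact pow_le_pow_left₀ (abs_nonneg _) (hX i) _

theorem exists_abs_coord_max (j : Fin n) (x : EuclideanSpace ℝ (Fin n)) :
    ∃ i₀, ∀ i, |x i| ≤ |x i₀| := by
  obtain ⟨i₀, -, h⟩ := Finset.exists_max_image Finset.univ (fun i => |x i|) ⟨j, Finset.mem_univ j⟩
  exact ⟨i₀, fun i => h i (Finset.mem_univ i)⟩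

/-- Monomials are dominated by powers of the largest coordinate, so only the pure powers among the
hypotheses matter. For `n = 0` there is no coordinate and `X = 0` works, as `0 ^ 0 = 1`. -/
theorem norm_monom_smul_le_of_lacunary {C C' ρ ρ' : ℝ} (hC : 0 < C)
    (hbound : ∀ X v : ℝ, 0 ≤ X → 0 ≤ v → (∀ j, X ^ k j * v ≤ C * bmtWeight ω ρ (k j)) →
      ∀ m, X ^ m * v ≤ C' * bmtWeight ω ρ' m) (hk : k 0 = 0) (hmono : StrictMono k)
    (x : EuclideanSpace ℝ (Fin n))
    (h : ∀ (j : ℕ) (α : Fin n → ℕ), mlen α = k j → ‖monom α x • f x‖ ≤ C * bmtWeight ω ρ (k j))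
    (α : Fin n → ℕ) : ‖monom α x • f x‖ ≤ C' * bmtWeight ω ρ' (mlen α) := by
  obtain ⟨X, hX0, hX, hXj⟩ : ∃ X : ℝ, 0 ≤ X ∧ (∀ i, |x i| ≤ X) ∧
      ∀ j, X ^ k j * ‖f x‖ ≤ C * bmtWeight ω ρ (k j) := by
    rcases Nat.eq_zero_or_pos n with rfl | hn
    · refine ⟨0, le_rfl, fun i => i.elim0, fun j => ?_⟩
      rcases Nat.eq_zero_or_pos j with rfl | hj
      · have := h 0 0 (by rw [hk, mlen_zero])
        rw [monom_zero, one_smul] at this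
        have h1 : (0 : ℝ) ^ k 0 * ‖f x‖ = ‖f x‖ := by rw [hk, pow_zero, one_mul]
        rwa [h1]
      · have : k j ≠ 0 := by have := hmono hj; omega
        rw [zero_pow this, zero_mul]
        exact (mul_pos hC (bmtWeight_pos _ _ _)).le
    · obtain ⟨i₀, hi⟩ := exists_abs_coord_max ⟨0, hn⟩ x
      refine ⟨|x i₀|, abs_nonneg _, hi, fun j => ?_⟩
      have := h j (Pi.single i₀ (k j)) (mlen_single _ _)
      rwa [monom_single, norm_smul, norm_pow, Real.norm_eq_abs] at this
  rw [norm_smul, Real.norm_eq_abs]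
  exact (mul_le_mul_of_nonneg_right (abs_monom_le hX α) (norm_nonneg _)).trans
    (hbound X _ hX0 (norm_nonneg _) hXj _)

theorem derivNorm_top_le {O : Set (EuclideanSpace ℝ (Fin n))} (hO : IsOpen O) {C : ℝ}
    {α : Fin n → ℕ} (h : ∀ x ∈ O, ‖mderiv α f x‖ ≤ C) :
    derivNorm ∞ O α f ≤ ENNReal.ofReal C := by
  unfold derivNorm
  rw [eLpNorm_exponent_top]
  exact eLpNormEssSup_le_of_ae_bound ((ae_restrict_mem hO.measurableSet).mono h)

theorem norm_le_of_derivNorm_top {O : Set (EuclideanSpace ℝ (Fin n))} (hO : IsOpen O) {C : ℝ}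
    (hC : 0 ≤ C) (hf : ContDiff ℝ (⊤ : ℕ∞) f) {α : Fin n → ℕ}
    (h : derivNorm ∞ O α f ≤ ENNReal.ofReal C) {x : EuclideanSpace ℝ (Fin n)} (hx : x ∈ O) :
    ‖mderiv α f x‖ ≤ C := by
  have := (enorm_le_eLpNorm_top hO (contDiff_mderiv hf α).continuous hx).trans h
  rw [← ofReal_norm] at this
  exact (ENNReal.ofReal_le_ofReal_iff hC).1 this

/-- Functions whose decay and whose derivatives are controlled separately. -/
def separateClass (𝕜 : Type*) [RCLike 𝕜] (n : ℕ) (τ : ClassType) (ω : ℝ → ℝ) :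
    Set (EuclideanSpace ℝ (Fin n) → 𝕜) :=
  {f | ContDiff ℝ (⊤ : ℕ∞) f ∧ τ.Param fun ρ => τ.Param fun σ => ∃ C : ℝ, 0 < C ∧
    (∀ (α : Fin n → ℕ) (x : EuclideanSpace ℝ (Fin n)),
      ‖monom α x • f x‖ ≤ C * bmtWeight ω ρ (mlen α)) ∧
    (∀ (β : Fin n → ℕ) (x : EuclideanSpace ℝ (Fin n)),
      ‖mderiv β f x‖ ≤ C * bmtWeight ω σ (mlen β))}

theorem classSLac_subset_separateClass (hω : IsWeightFunction ω) (hk : IsSpecialBaseSequence k)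
    (hl : IsSpecialBaseSequence l) (τ : ClassType) :
    classSLac 𝕜 n τ ω k l ⊆ separateClass 𝕜 n τ ω := by
  rintro f ⟨hf, h⟩
  obtain ⟨L₁, hL₁, h₁⟩ := exists_moment_bound_of_lacunary hω hk
  obtain ⟨L₂, hL₂, h₂⟩ := exists_derivNorm_bound_of_lacunary (𝕜 := 𝕜) n hω hl
  refine ⟨hf, h.transfer' hL₁ fun ρ hρ h => h.transfer' hL₂ ?_⟩
  rintro σ hσ ⟨C, hC, hb⟩
  obtain ⟨C₁, hC₁, h₁⟩ := h₁ ρ hρ C hC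
  obtain ⟨C₂, hC₂, h₂⟩ := h₂ σ hσ 1 le_rfl C hC
  refine ⟨C₁ + C₂, by positivity, fun α x => ?_, fun β x => ?_⟩
  · refine (norm_monom_smul_le_of_lacunary hC h₁ hk.1.1 hk.1.2 x
      (fun j α hα => (hb j).1 α x hα) α).trans ?_
    have := bmtWeight_pos ω (L₁ * ρ) (mlen α)
    gcongr
    linarith
  · have := h₂ ∞ le_top (fun _ => univ) (fun _ => isOpen_univ)
      (fun _ _ _ _ _ _ _ _ _ _ _ => mem_univ _) f hf
      (fun q _ j β hβ => derivNorm_top_le isOpen_univ fun x _ => (hb j).2 β x hβ) β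
    have hW := bmtWeight_pos ω (L₂ * σ) (mlen β)
    refine (norm_le_of_derivNorm_top isOpen_univ (by positivity) hf this (mem_univ x)).trans ?_
    gcongr
    linarith

/-- Pointwise interpolation: at a point `x`, the derivatives of order `i` are controlled by the
geometric mean of the decay of `f` near `x` and the global bound of the derivatives of order
`2 * i`. -/
theorem abs_pow_mul_norm_mderiv_le (hω : IsWeightFunction ω) {ρ σ C D : ℝ} (hρ : 0 < ρ)
    (hσ : 0 < σ) (hC : 0 < C) (hD : 1 ≤ D)
    (hfac : ∀ k : ℕ, 1 ≤ k → ((k : ℝ) / (1 / (n + 1))) ^ k ≤ D * bmtWeight ω σ k)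
    (hf : ContDiff ℝ (⊤ : ℕ∞) f)
    (hdec : ∀ (α : Fin n → ℕ) (x : EuclideanSpace ℝ (Fin n)),
      ‖monom α x • f x‖ ≤ C * bmtWeight ω ρ (mlen α))
    (hder : ∀ (β : Fin n → ℕ) (x : EuclideanSpace ℝ (Fin n)),
      ‖mderiv β f x‖ ≤ C * bmtWeight ω σ (mlen β))
    (β : Fin n → ℕ) (hβ : 1 ≤ mlen β) (m : ℕ) (j : Fin n) (x : EuclideanSpace ℝ (Fin n)) :
    |x j| ^ m * ‖mderiv β f x‖ ≤ (2 * C * C * D + 1) * (2 ^ m * bmtWeight ω (2 * ρ) m) *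
      ((interpConst n ^ 2) ^ mlen β * bmtWeight ω (2 * σ) (mlen β)) := by
  set i := mlen β with hi
  set K := interpConst n with hK
  have hK1 : 1 ≤ K := one_le_interpConst n
  have hK0 : 0 < K := by linarith
  have hD0 : 0 < D := by linarith
  have hWρ := bmtWeight_pos ω (2 * ρ) m
  have hWσ := bmtWeight_pos ω (2 * σ) i
  have hWρ2 := bmtWeight_pos ω ρ (2 * m)
  have hWσ2 := bmtWeight_pos ω σ (2 * i)
  rcases (pow_nonneg (abs_nonneg (x j)) m).eq_or_lt with h0 | hX
  · rw [← h0, zero_mul]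
    positivity
  set X := |x j| with hXdef
  have hT : 0 < X ^ (2 * m) := by rw [mul_comm, pow_mul]; positivity
  set G := 4 ^ m * (2 * C * bmtWeight ω ρ (2 * m)) with hG
  have hG0 : 0 < G := by positivity
  -- `η` bounds `f` on the unit ball around `x`: `C` from the derivative bound of order `0`, and `G
  -- / X ^ (2m)` from the decay, since `|x j| ≤ |y j| + 1` there. The minimum with `C` later keeps
  -- `R` large, hence the step small.
  set η := min C (G / X ^ (2 * m)) with hη
  have hη0 : 0 < η := lt_min hC (by positivity)
  have hfη : ∀ y ∈ Metric.ball x 1, ‖f y‖ ≤ η := by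
    intro y hy
    refine le_min ?_ ?_
    · have := hder 0 y
      rw [mderiv_zero, mlen_zero] at this
      exact this.trans (mul_le_of_le_one_right hC.le (bmtWeight_zero_le_one hω hσ))
    · rw [le_div_iff₀ hT]
      have hxy : X ≤ |y j| + 1 := by
        have h1 : ‖(x - y) j‖ ≤ ‖x - y‖ := PiLp.norm_apply_le _ j
        rw [← dist_eq_norm, dist_comm, PiLp.sub_apply, Real.norm_eq_abs] at h1
        have h2 := Metric.mem_ball.1 hy
        have h3 := abs_sub_abs_le_abs_sub (x j) (y j)
        linarith
      have h2m : X ^ (2 * m) ≤ 4 ^ m * (1 + |y j| ^ (2 * m)) := by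
        have h4 : (4 : ℝ) ^ m = 2 ^ (2 * m) := by rw [pow_mul]; norm_num
        rw [h4]
        rcases le_total |y j| 1 with h | h
        · calc X ^ (2 * m) ≤ 2 ^ (2 * m) := pow_le_pow_left₀ (abs_nonneg _) (by linarith) _
            _ ≤ 2 ^ (2 * m) * (1 + |y j| ^ (2 * m)) := by
              refine le_mul_of_one_le_right (by positivity) ?_
              have : 0 ≤ |y j| ^ (2 * m) := by positivity
              linarith
        · calc X ^ (2 * m) ≤ (2 * |y j|) ^ (2 * m) :=
                pow_le_pow_left₀ (abs_nonneg _) (by linarith) _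
            _ = 2 ^ (2 * m) * |y j| ^ (2 * m) := mul_pow _ _ _
            _ ≤ _ := by gcongr; linarith
      have e0 := hdec 0 y
      rw [monom_zero, one_smul, mlen_zero] at e0
      have e1 := hdec (Pi.single j (2 * m)) y
      rw [monom_single, norm_smul, norm_pow, Real.norm_eq_abs, mlen_single] at e1
      have e2 : C * bmtWeight ω ρ 0 ≤ C * bmtWeight ω ρ (2 * m) := by
        gcongr
        exact bmtWeight_mono hω hρ (Nat.zero_le _)
      calc ‖f y‖ * X ^ (2 * m) ≤ ‖f y‖ * (4 ^ m * (1 + |y j| ^ (2 * m))) := by gcongr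
        _ = 4 ^ m * (‖f y‖ + |y j| ^ (2 * m) * ‖f y‖) := by ring
        _ ≤ 4 ^ m * (C * bmtWeight ω ρ (2 * m) + C * bmtWeight ω ρ (2 * m)) := by
          gcongr
          exact e0.trans e2
        _ = G := by rw [hG]; ring
  obtain ⟨R, hR, hRk⟩ := exists_root_pow (y := C * D * bmtWeight ω σ (2 * i) / η)
    (by positivity) (k := 2 * i) (by omega)
  have hηR : η * R ^ (2 * i) = C * D * bmtWeight ω σ (2 * i) := by rw [hRk]; field_simp
  have hδ0 : (0 : ℝ) < 1 / (n + 1) := by positivity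
  have hDR : D * bmtWeight ω σ (2 * i) ≤ R ^ (2 * i) := by
    rw [hRk, le_div_iff₀ hη0]
    calc _ ≤ D * bmtWeight ω σ (2 * i) * C := by gcongr; exact min_le_left _ _
      _ = _ := by ring
  -- Radii `(q + 1) / (n + 1)` with `q ≤ n` keep all sets in the unit ball, which explains `δ = 1 /
  -- (n + 1)` in `hfac`.
  set S : ℕ → Set (EuclideanSpace ℝ (Fin n)) :=
    fun q => Metric.thickening ((q + 1) * (1 / (n + 1))) {x} with hS
  have hSball : ∀ q ≤ n, S q ⊆ Metric.ball x 1 := by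
    intro q hq
    rw [hS, ← Metric.thickening_singleton]
    refine Metric.thickening_mono ?_ _
    rw [mul_one_div, div_le_one (by positivity)]
    gcongr
  have key := derivNorm_interpolate (p := ∞) le_top (S := S) (fun q => Metric.isOpen_thickening) hf
    (a := 0) (k := 2 * i) (by omega) hη0.le hR
    (shiftsInto_thickening (DominatesFactorial.div_le hδ0 hR hfac (by omega) hDR) _)
    (fun q hq γ hγ => derivNorm_top_le Metric.isOpen_thickening fun y hy => by
      rw [eq_zero_of_mlen hγ, mderiv_zero]
      exact hfη y (hSball q hq hy))
    (fun q hq γ hγ => derivNorm_top_le Metric.isOpen_thickening fun y hy => by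
      refine (hder γ y).trans ?_
      rw [hγ, zero_add, hηR]
      gcongr
      exact le_mul_of_one_le_right hC.le hD)
    (i := i) (by omega) (α := β) (by omega)
  have hpt := norm_le_of_derivNorm_top Metric.isOpen_thickening (by positivity) hf key
    (Metric.self_subset_thickening (by positivity) _ (mem_singleton x))
  -- Order `i` is the midpoint of `0` and `2 * i`, so the square splits into `η * X ^ (2m)`,
  -- controlled by decay, and `η * R ^ (2i)`, controlled by the derivatives; both right-hand sides
  -- are squares up to constants by `bmtWeight_two_mul`.
  have hsq : (X ^ m * (η * R ^ i)) ^ 2 ≤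
      ((2 * C * C * D + 1) * (2 ^ m * bmtWeight ω (2 * ρ) m) * bmtWeight ω (2 * σ) i) ^ 2 := by
    have hηG : η * X ^ (2 * m) ≤ G := by
      rw [← le_div_iff₀ hT]; exact min_le_right _ _
    have e1 : (X ^ m * (η * R ^ i)) ^ 2 = (η * X ^ (2 * m)) * (η * R ^ (2 * i)) := by
      rw [mul_comm 2 m, mul_comm 2 i, pow_mul, pow_mul]; ring
    have h4 : (4 : ℝ) ^ m = (2 ^ m) ^ 2 := by rw [← pow_mul, mul_comm, pow_mul]; norm_num
    rw [e1, hηR]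
    calc _ ≤ G * (C * D * bmtWeight ω σ (2 * i)) := by gcongr
      _ = (2 * C * C * D) * (2 ^ m * bmtWeight ω (2 * ρ) m * bmtWeight ω (2 * σ) i) ^ 2 := by
        rw [hG, bmtWeight_two_mul ρ hρ, bmtWeight_two_mul σ hσ, h4]; ring
      _ ≤ (2 * C * C * D + 1) ^ 2 * (2 ^ m * bmtWeight ω (2 * ρ) m * bmtWeight ω (2 * σ) i) ^ 2 := by
        have : 0 ≤ 2 * C * C * D := by positivity
        gcongr
        nlinarith
      _ = _ := by ring
  have hle := (pow_le_pow_iff_left₀ (by positivity) (by positivity) two_ne_zero).1 hsq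
  calc X ^ m * ‖mderiv β f x‖ ≤ X ^ m * (K ^ (2 * i) * (η * R ^ i)) := by gcongr
    _ = K ^ (2 * i) * (X ^ m * (η * R ^ i)) := by ring
    _ ≤ K ^ (2 * i) * ((2 * C * C * D + 1) * (2 ^ m * bmtWeight ω (2 * ρ) m) *
        bmtWeight ω (2 * σ) i) := by gcongr
    _ = _ := by rw [pow_mul]; ring

theorem separateClass_subset_classS (hω : IsWeightFunction ω) {τ : ClassType} (hτ : τ.Growth ω) :
    separateClass 𝕜 n τ ω ⊆ classS 𝕜 n τ ω := by
  rintro f ⟨hf, h⟩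
  obtain ⟨L₁, hL₁, h₁⟩ := bmtWeight_pow hω 2
  obtain ⟨L₂, hL₂, h₂⟩ := bmtWeight_pow hω (interpConst n ^ 2)
  have hδ1 : (1 : ℝ) / (n + 1) ≤ 1 := by
    rw [div_le_one (by positivity)]
    have : (0 : ℝ) ≤ n := Nat.cast_nonneg n
    linarith
  refine ⟨hf, h.transfer' (by positivity : 0 < L₁ * 2) fun ρ hρ h =>
    h.transfer (by positivity : 0 < L₂ * 2) (hτ.ample hω (by positivity) hδ1) ?_ ?_⟩
  · rintro σ σ' hσ hσσ' ⟨C, hC, hdec, hder⟩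
    have he : 1 ≤ Real.exp (ω 1 / σ') :=
      Real.one_le_exp (div_nonneg (hω.nonneg 1 zero_le_one) (hσ.trans_le hσσ').le)
    refine ⟨C * Real.exp (ω 1 / σ'), by positivity, fun α x => (hdec α x).trans ?_,
      fun β x => (hder β x).trans ?_⟩
    · have := bmtWeight_pos ω ρ (mlen α)
      gcongr
      exact le_mul_of_one_le_right hC.le he
    · rw [mul_assoc]
      gcongr
      exact bmtWeight_le_of_le hω hσ hσσ' _
  · rintro σ hσ ⟨D, hD, hfac⟩ ⟨C, hC, hdec, hder⟩
    obtain ⟨D₁, hD₁, h₁⟩ := h₁ (2 * ρ) (by positivity)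
    obtain ⟨D₂, hD₂, h₂⟩ := h₂ (2 * σ) (by positivity)
    simp only [abs_of_nonneg (zero_le_two (α := ℝ)), abs_of_nonneg (sq_nonneg (interpConst n)),
      ← mul_assoc] at h₁ h₂
    have hD0 : 0 < D := by linarith
    have hω1 := hω.nonneg 1 zero_le_one
    set W₀ := bmtWeight ω (L₂ * 2 * σ) 0 with hW₀def
    have hW₀ : 0 < W₀ := bmtWeight_pos _ _ _
    set E₁ := (2 * C * C * D + 1) * D₁ * D₂ with hE₁
    -- `E₂` covers `β = 0`, where the decay of `f` alone is used; dividing by `W₀` creates the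
    -- weight of order `0` demanded by the product form.
    set E₂ := C * Real.exp (ω 1 / (2 * ρ)) * D₁ / W₀ with hE₂
    have hE₁0 : 0 < E₁ := by positivity
    have hE₂0 : 0 < E₂ := by positivity
    refine ⟨E₁ + E₂, by positivity, fun α β x => ?_⟩
    have hWα := bmtWeight_pos ω (L₁ * 2 * ρ) (mlen α)
    have hWβ := bmtWeight_pos ω (L₂ * 2 * σ) (mlen β)
    rcases Nat.eq_zero_or_pos (mlen β) with h0 | hpos
    · rw [h0, eq_zero_of_mlen h0, mderiv_zero]
      refine (hdec α x).trans ?_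
      have e1 := bmtWeight_le_of_le hω hρ (by linarith : ρ ≤ 2 * ρ) (mlen α)
      have e2 : bmtWeight ω (2 * ρ) (mlen α) ≤ D₁ * bmtWeight ω (L₁ * 2 * ρ) (mlen α) :=
        (le_mul_of_one_le_left (bmtWeight_pos _ _ _).le (one_le_pow₀ one_le_two)).trans (h₁ _)
      calc C * bmtWeight ω ρ (mlen α) ≤ C * (Real.exp (ω 1 / (2 * ρ)) *
            (D₁ * bmtWeight ω (L₁ * 2 * ρ) (mlen α))) := by
            gcongr
            exact e1.trans (by gcongr)
        _ = E₂ * (bmtWeight ω (L₁ * 2 * ρ) (mlen α) * W₀) := by rw [hE₂]; field_simp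
        _ ≤ _ := by gcongr; linarith
    -- A nonzero `β` guarantees that a coordinate exists; the one of largest modulus then dominates
    -- the monomial.
    · obtain ⟨j₀, -⟩ : ∃ j, β j ≠ 0 := by
        by_contra! hcon
        have : mlen β = 0 := Finset.sum_eq_zero fun i _ => hcon i
        omega
      obtain ⟨j, hj⟩ := exists_abs_coord_max j₀ x
      rw [norm_smul, Real.norm_eq_abs]
      calc _ ≤ |x j| ^ mlen α * ‖mderiv β f x‖ := by
            gcongr
            exact abs_monom_le hj α
        _ ≤ _ := abs_pow_mul_norm_mderiv_le hω hρ hσ hC hD hfac hf hdec hder β hpos _ j x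
        _ ≤ (2 * C * C * D + 1) * (D₁ * bmtWeight ω (L₁ * 2 * ρ) (mlen α)) *
            (D₂ * bmtWeight ω (L₂ * 2 * σ) (mlen β)) := by
            have i1 := one_le_interpConst n
            have i2 := bmtWeight_pos ω (2 * σ) (mlen β)
            have i3 := h₁ (mlen α)
            have i4 := h₂ (mlen β)
            gcongr
        _ = E₁ * (bmtWeight ω (L₁ * 2 * ρ) (mlen α) * bmtWeight ω (L₂ * 2 * σ) (mlen β)) := by
            rw [hE₁]; ring
        _ ≤ _ := by gcongr; linarith

theorem classS_subset_classSLac (hω : IsWeightFunction ω) (k l : ℕ → ℕ) (τ : ClassType) :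
    classS 𝕜 n τ ω ⊆ classSLac 𝕜 n τ ω k l := by
  rintro f ⟨hf, h⟩
  refine ⟨hf, h.mono fun ρ hρ h => h.mono ?_⟩
  rintro σ hσ ⟨C, hC, hb⟩
  refine ⟨C, hC, fun j => ⟨fun α x hα => ?_, fun β x hβ => ?_⟩⟩
  · have := hb α 0 x
    rw [mderiv_zero, mlen_zero, hα] at this
    refine this.trans ?_
    gcongr
    exact mul_le_of_le_one_right (bmtWeight_pos _ _ _).le (bmtWeight_zero_le_one hω hσ)
  · have := hb 0 β x
    rw [monom_zero, one_smul, mlen_zero, hβ] at this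
    refine this.trans ?_
    gcongr
    exact mul_le_of_le_one_left (bmtWeight_pos _ _ _).le (bmtWeight_zero_le_one hω hρ)

theorem classSLac_eq (hω : IsWeightFunction ω) (hk : IsSpecialBaseSequence k)
    (hl : IsSpecialBaseSequence l) {τ : ClassType} (hτ : τ.Growth ω) :
    classSLac 𝕜 n τ ω k l = classS 𝕜 n τ ω :=
  Subset.antisymm ((classSLac_subset_separateClass hω hk hl τ).trans
    (separateClass_subset_classS hω hτ)) (classS_subset_classSLac hω k l τ)

end GelfandShilov

end LacunaryBMT

end

theorem mainTheorem4 (𝕜 : Type*) [RCLike 𝕜] (n : ℕ) (p : ℝ≥0∞) (hp : 1 ≤ p)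
    (k l : ℕ → ℕ) (hk : LacunaryBMT.IsSpecialBaseSequence k)
    (hl : LacunaryBMT.IsSpecialBaseSequence l)
    (ω : ℝ → ℝ) (hω : LacunaryBMT.IsWeightFunction ω) (τ : LacunaryBMT.ClassType) :
    LacunaryBMT.classBLac 𝕜 n τ ω p k = LacunaryBMT.classB 𝕜 n τ ω p ∧
    LacunaryBMT.classDLac 𝕜 n τ ω k = LacunaryBMT.classD 𝕜 n τ ω ∧
    (τ.Growth ω →
      (∀ U : Set (EuclideanSpace ℝ (Fin n)), IsOpen U →
        LacunaryBMT.classELac 𝕜 τ ω p k U = LacunaryBMT.classE 𝕜 τ ω p U) ∧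
      LacunaryBMT.classSLac 𝕜 n τ ω k l = LacunaryBMT.classS 𝕜 n τ ω) := by
  refine ⟨LacunaryBMT.classBLac_eq hω hk τ hp, ?_, fun hτ =>
    ⟨fun U hU => LacunaryBMT.classELac_eq hω hk hτ hp hU, LacunaryBMT.classSLac_eq hω hk hl hτ⟩⟩
  unfold LacunaryBMT.classDLac LacunaryBMT.classD
  rw [LacunaryBMT.classBLac_eq hω hk τ le_top]
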